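/- All algebras and vector spaces are complex. An operator space is a Banach space $V$ with norms on all matrix spaces $M_n(V)$ (extending that of $V=M_1(V)$) satisfying Ruan's axioms $\|x\oplus y\|=\max\{\|x\|,\|y\|\}$ and $\|\alpha x\beta\|\le\|\alpha\|\,\|x\|\,\|\beta\|$ for scalar matrices $\alpha,\beta$. A linear map is completely bounded if its amplifications to matrices are uniformly bounded; a bilinear map $\varphi:V\times W\to X$ is (jointly) completely bounded if there is a $C$ with $\|(\varphi(x_{ij},y_{kl}))\|\le C\|x\|\,\|y\|$ for all $m,n$ and all $x\in M_m(V)$, $y\in M_n(W)$. The dual $V^*$ is an operator space via $M_n(V^*)=\mathcal{CB}(V,M_n)$. The projective tensor product $V\hat\otimes W$ is the completion of $V\otimes W$ with respect to the matrix norms $\|u\|=\inf\{\|\alpha\|\,\|x\|\,\|y\|\,\|\beta\| : u=\alpha(x\otimes y)\beta\}$, where $x$, $y$ are square matrices over $V$, $W$ and $\alpha$, $\beta$ are scalar matrices of suitable sizes. A quantized Banach algebra is an algebra $A$ (not necessarily unital) which is also an operator space such that the multiplication is completely bounded. A quantized Banach $A$-bimodule is an $A$-bimodule $E$ which is also an operator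 space such that both module actions $A\times E\to E$ and $E\times A\to E$ are completely bounded; its dual $E^*$ carries the actions $(a\cdot\phi)(x)=\phi(x\cdot a)$ and $(\phi\cdot a)(x)=\phi(a\cdot x)$. The algebra $A$ is operator amenable if, for every quantized Banach $A$-bimodule $E$, every completely bounded derivation $D:A\to E^*$ is inner, i.e. of the form $D(a)=a\cdot\phi-\phi\cdot a$ for some $\phi\in E^*$. It is operator biprojective if the multiplication operator $\Delta:A\hat\otimes A\to A$, $a\otimes b\mapsto ab$, has a completely bounded right inverse which is a homomorphism of $A$-bimodules, where $a\cdot(x\otimes y)=ax\otimes y$ and $(x\otimes y)\cdot a=x\otimes ya$. **Proposition.** Let $A$ be a commutative quantized Banach algebra which 1. is semisimple (its Jacobson radical, the intersection of its maximal modular ideals, is $\{0\}$), 2. is Tauberian (the elements whose Gelfand transform has compact support in the character space are dense in $A$), 3. has a discrete character space (the set of nonzero multiplicative linear functionals, with the weak$^*$ topology), and 4. has a bounded approximate identity. Then $A$ is operator biprojective if and only if $A$ is operator amenable. -/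

import Mathlib

open scoped TensorProduct
open Filter Topology

set_option linter.unusedSectionVars false

noncomputable section

namespace OpSpace

universe u v w

/-! ### Scalar matrices -/

/-- The operator norm of a rectangular scalar matrix, acting between the Hilbert spaces
`ℓ²(κ)` and `ℓ²(ι)`. -/
def opNorm {ι κ : Type} [Fintype ι] [Fintype κ] (α : Matrix ι κ ℂ) : ℝ :=
  letI := Classical.decEq κ
  ‖LinearMap.toContinuousLinearMap (Matrix.toEuclideanLin α)‖

section opNorm

variable {ι κ μ ι' κ' : Type} [Fintype ι] [Fintype κ] [Fintype μ] [Fintype ι'] [Fintype κ']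

lemma opNorm_nonneg (α : Matrix ι κ ℂ) : 0 ≤ opNorm α := norm_nonneg _

lemma opNorm_sq_sum_le (α : Matrix ι κ ℂ) (x : κ → ℂ) :
    ∑ i, ‖∑ j, α i j * x j‖ ^ 2 ≤ opNorm α ^ 2 * ∑ j, ‖x j‖ ^ 2 := by
  classical
  have h := (LinearMap.toContinuousLinearMap (Matrix.toEuclideanLin α)).le_opNorm
    (WithLp.toLp 2 x)
  have h2 := pow_le_pow_left₀ (norm_nonneg _) h 2
  rw [mul_pow, EuclideanSpace.norm_sq_eq, EuclideanSpace.norm_sq_eq] at h2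
  have e : opNorm α = ‖LinearMap.toContinuousLinearMap (Matrix.toEuclideanLin α)‖ := by
    unfold opNorm; congr!
  rw [e]
  simpa [Matrix.mulVec, dotProduct] using h2

lemma opNorm_le_of (α : Matrix ι κ ℂ) {C : ℝ} (hC : 0 ≤ C)
    (h : ∀ x : κ → ℂ, ∑ i, ‖∑ j, α i j * x j‖ ^ 2 ≤ C ^ 2 * ∑ j, ‖x j‖ ^ 2) : opNorm α ≤ C := by
  classical
  have e : opNorm α = ‖LinearMap.toContinuousLinearMap (Matrix.toEuclideanLin α)‖ := by
    unfold opNorm; congr!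
  rw [e]
  refine ContinuousLinearMap.opNorm_le_bound _ hC fun x => ?_
  refine (pow_le_pow_iff_left₀ (norm_nonneg _) (by positivity) two_ne_zero).1 ?_
  rw [mul_pow, EuclideanSpace.norm_sq_eq, EuclideanSpace.norm_sq_eq]
  simpa [Matrix.mulVec, dotProduct] using h x

lemma opNorm_add_le (α β : Matrix ι κ ℂ) : opNorm (α + β) ≤ opNorm α + opNorm β := by
  unfold opNorm
  rw [map_add, map_add]
  exact norm_add_le _ _

lemma opNorm_smul (c : ℂ) (α : Matrix ι κ ℂ) : opNorm (c • α) = ‖c‖ * opNorm α := by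
  unfold opNorm
  rw [map_smul, map_smul, norm_smul]

lemma opNorm_zero : opNorm (0 : Matrix ι κ ℂ) = 0 := by
  unfold opNorm; simp

lemma opNorm_conjTranspose (α : Matrix ι κ ℂ) : opNorm α.conjTranspose = opNorm α := by
  classical
  have := Matrix.l2_opNorm_conjTranspose (𝕜 := ℂ) α
  rw [Matrix.l2_opNorm_def, Matrix.l2_opNorm_def] at this
  unfold opNorm
  convert this using 1 <;> congr!

lemma opNorm_mul_le (α : Matrix ι κ ℂ) (β : Matrix κ μ ℂ) :
    opNorm (α * β) ≤ opNorm α * opNorm β := by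
  refine opNorm_le_of _ (mul_nonneg (opNorm_nonneg _) (opNorm_nonneg _)) fun x => ?_
  have h1 := opNorm_sq_sum_le α (fun j => ∑ k, β j k * x k)
  have h2 := mul_le_mul_of_nonneg_left (opNorm_sq_sum_le β x) (sq_nonneg (opNorm α))
  refine le_trans (le_of_eq ?_) (h1.trans (h2.trans (le_of_eq (by ring))))
  refine Finset.sum_congr rfl fun i _ => ?_
  congr 2
  simp only [Matrix.mul_apply, Finset.sum_mul, Finset.mul_sum]
  rw [Finset.sum_comm]
  simp only [mul_assoc]

lemma opNorm_submatrix_equiv (α : Matrix ι κ ℂ) (e : ι' ≃ ι) (f : κ' ≃ κ) :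
    opNorm (α.submatrix e f) ≤ opNorm α := by
  refine opNorm_le_of _ (opNorm_nonneg _) fun x => ?_
  have h := opNorm_sq_sum_le α (x ∘ f.symm)
  rw [← e.sum_comp, ← f.sum_comp (fun j => ‖(x ∘ f.symm) j‖ ^ 2)] at h
  simp only [← f.sum_comp (fun j => α _ j * (x ∘ f.symm) j)] at h
  simpa using h

lemma opNorm_one_le [DecidableEq ι] : opNorm (1 : Matrix ι ι ℂ) ≤ 1 := by
  refine opNorm_le_of _ zero_le_one fun x => ?_
  simp [Matrix.one_apply]

/-- block diagonal -/
lemma opNorm_fromBlocks_le (α : Matrix ι κ ℂ) (β : Matrix ι' κ' ℂ) :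
    opNorm (Matrix.fromBlocks α 0 0 β) ≤ max (opNorm α) (opNorm β) := by
  have hm : 0 ≤ max (opNorm α) (opNorm β) := (opNorm_nonneg α).trans (le_max_left _ _)
  refine opNorm_le_of _ hm fun x => ?_
  have h1 := opNorm_sq_sum_le α (x ∘ Sum.inl)
  have h2 := opNorm_sq_sum_le β (x ∘ Sum.inr)
  have h3 := pow_le_pow_left₀ (opNorm_nonneg α) (le_max_left _ (opNorm β)) 2
  have h4 := pow_le_pow_left₀ (opNorm_nonneg β) (le_max_right (opNorm α) _) 2
  have h5 := mul_le_mul_of_nonneg_right h3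
    (show 0 ≤ ∑ j, ‖x (Sum.inl j)‖ ^ 2 by positivity)
  have h6 := mul_le_mul_of_nonneg_right h4
    (show 0 ≤ ∑ j, ‖x (Sum.inr j)‖ ^ 2 by positivity)
  simp only [Fintype.sum_sum_type, Matrix.fromBlocks_apply₁₁, Matrix.fromBlocks_apply₁₂,
    Matrix.fromBlocks_apply₂₁, Matrix.fromBlocks_apply₂₂, Matrix.zero_apply, zero_mul,
    Finset.sum_const_zero, add_zero, zero_add, mul_add]
  simp only [Function.comp_apply] at h1 h2
  linarith

/-- `α ⊗ 1` -/
lemma opNorm_amp_le [DecidableEq μ] (α : Matrix ι κ ℂ) :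
    opNorm (Matrix.kroneckerMap (· * ·) α (1 : Matrix μ μ ℂ)) ≤ opNorm α := by
  refine opNorm_le_of _ (opNorm_nonneg _) fun x => ?_
  simp only [Fintype.sum_prod_type, Matrix.kroneckerMap_apply, Matrix.one_apply, mul_ite, mul_one,
    mul_zero, ite_mul, zero_mul, Finset.sum_ite_eq, Finset.mem_univ, if_true]
  rw [Finset.sum_comm, Finset.sum_comm (γ := κ), Finset.mul_sum]
  exact Finset.sum_le_sum fun m _ => opNorm_sq_sum_le α (fun k => x (k, m))

lemma sum_sq_column (α : Matrix ι Unit ℂ) : opNorm α ^ 2 = ∑ i, ‖α i ()‖ ^ 2 := by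
  apply le_antisymm
  · have : opNorm α ≤ √(∑ i, ‖α i ()‖ ^ 2) := by
      refine opNorm_le_of _ (Real.sqrt_nonneg _) fun x => ?_
      rw [Real.sq_sqrt (by positivity)]
      simp [mul_pow, Finset.sum_mul]
    have h := pow_le_pow_left₀ (opNorm_nonneg _) this 2
    rwa [Real.sq_sqrt (by positivity)] at h
  · simpa using opNorm_sq_sum_le α (fun _ => 1)

lemma norm_entry_le_opNorm (α : Matrix ι κ ℂ) (i : ι) (j : κ) : ‖α i j‖ ≤ opNorm α := by
  classical
  have h := opNorm_sq_sum_le α (fun k => if k = j then 1 else 0)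
  simp only [mul_ite, mul_one, mul_zero, Finset.sum_ite_eq', Finset.mem_univ, if_true] at h
  have h2 : ‖α i j‖ ^ 2 ≤ ∑ i, ‖α i j‖ ^ 2 :=
    Finset.single_le_sum (f := fun i => ‖α i j‖ ^ 2) (fun _ _ => sq_nonneg _) (Finset.mem_univ i)
  have h3 : ∑ k, ‖(if k = j then (1:ℂ) else 0)‖ ^ 2 = 1 := by
    rw [Finset.sum_eq_single j] <;> simp +contextual
  rw [h3, mul_one] at h
  exact (pow_le_pow_iff_left₀ (norm_nonneg _) (opNorm_nonneg _) two_ne_zero).1 (h2.trans h)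

end opNorm

/-! ### Operator spaces -/

/-- The product `α v β` of scalar matrices `α`, `β` and a `V`-valued matrix `v`. -/
def cmul {V : Type u} [AddCommGroup V] [Module ℂ V] {ι κ : Type} [Fintype ι]
    (α : Matrix κ ι ℂ) (v : Matrix ι ι V) (β : Matrix ι κ ℂ) : Matrix κ κ V :=
  Matrix.of fun k l => ∑ i, ∑ j, (α k i * β j l) • v i j

/-- An (abstract) operator space structure on a normed space `V`, by Ruan's axioms: a norm on every
matrix space `M_ι(V)`, compatible with the norm of `V`, such that
`‖v ⊕ w‖ = max ‖v‖ ‖w‖` and `‖α v β‖ ≤ ‖α‖ ‖v‖ ‖β‖`. The matrices are indexed by finite types `ι`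
rather than by the sets `{1, …, n}` only; by the last axiom, applied to permutation matrices,
the norm does not depend on the labelling. (For a seminormed `V` the matrix norms are only
seminorms; for a normed `V` the axioms imply that they are norms.) -/
class OperatorSpace (V : Type u) [SeminormedAddCommGroup V] [NormedSpace ℂ V] where
  mnorm : ∀ {ι : Type} [Fintype ι], Matrix ι ι V → ℝ
  mnorm_add_le : ∀ {ι : Type} [Fintype ι] (v w : Matrix ι ι V), mnorm (v + w) ≤ mnorm v + mnorm w
  mnorm_smul : ∀ {ι : Type} [Fintype ι] (c : ℂ) (v : Matrix ι ι V), mnorm (c • v) = ‖c‖ * mnorm v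
  mnorm_unit : ∀ x : V, mnorm (Matrix.of fun _ _ : Unit => x) = ‖x‖
  mnorm_fromBlocks : ∀ {ι κ : Type} [Fintype ι] [Fintype κ] (v : Matrix ι ι V) (w : Matrix κ κ V),
    mnorm (Matrix.fromBlocks v 0 0 w) = max (mnorm v) (mnorm w)
  mnorm_cmul_le : ∀ {ι κ : Type} [Fintype ι] [Fintype κ] (α : Matrix κ ι ℂ) (v : Matrix ι ι V)
    (β : Matrix ι κ ℂ), mnorm (cmul α v β) ≤ opNorm α * mnorm v * opNorm β


section selection

variable {ι κ μ : Type} [Fintype ι] [Fintype κ] [Fintype μ]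

/-- The matrix of a map of index sets: `(sel f) k i = 1` if `i = f k`, and `0` otherwise. -/
def sel (f : κ → ι) : Matrix κ ι ℂ :=
  letI := Classical.decEq ι
  Matrix.of fun k i => if i = f k then 1 else 0

lemma sel_apply [DecidableEq ι] (f : κ → ι) (k : κ) (i : ι) :
    sel f k i = if i = f k then 1 else 0 := by
  simp only [sel, Matrix.of_apply]; congr

lemma opNorm_sel_le (f : κ → ι) (hf : Function.Injective f) : opNorm (sel f) ≤ 1 := by
  classical
  refine opNorm_le_of _ zero_le_one fun x => ?_
  simp only [sel_apply, ite_mul, one_mul, zero_mul, Finset.sum_ite_eq', Finset.mem_univ, if_true,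
    one_pow]
  rw [← Finset.sum_image (f := fun i => ‖x i‖ ^ 2) (s := Finset.univ) (g := f)
    (fun a _ b _ h => hf h)]
  exact Finset.sum_le_sum_of_subset_of_nonneg (Finset.subset_univ _) fun _ _ _ => sq_nonneg _

lemma opNorm_sel_transpose_le (f : κ → ι) (hf : Function.Injective f) :
    opNorm (sel f).transpose ≤ 1 := by
  classical
  have : (sel f).transpose = (sel f).conjTranspose := by
    ext i k
    simp only [Matrix.transpose_apply, Matrix.conjTranspose_apply, sel_apply]
    split_ifs <;> simp
  rw [this, opNorm_conjTranspose]
  exact opNorm_sel_le f hf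

variable {V : Type u} [AddCommGroup V] [Module ℂ V]

lemma cmul_sel (f g : κ → ι) (v : Matrix ι ι V) :
    cmul (sel f) v (sel g).transpose = Matrix.of fun k l => v (f k) (g l) := by
  classical
  ext k l
  simp only [cmul, Matrix.of_apply, Matrix.transpose_apply, sel_apply]
  simp

lemma cmul_sel' (f : κ → ι) (v : Matrix ι ι V) :
    cmul (sel f) v (sel f).transpose = v.submatrix f f := cmul_sel f f v

lemma cmul_add (α : Matrix κ ι ℂ) (v w : Matrix ι ι V) (β : Matrix ι κ ℂ) :
    cmul α (v + w) β = cmul α v β + cmul α w β := by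
  ext k l
  simp [cmul, smul_add, Finset.sum_add_distrib]

lemma cmul_cmul (γ : Matrix μ κ ℂ) (α : Matrix κ ι ℂ) (v : Matrix ι ι V) (β : Matrix ι κ ℂ)
    (δ : Matrix κ μ ℂ) : cmul γ (cmul α v β) δ = cmul (γ * α) v (β * δ) := by
  ext k l
  simp only [cmul, Matrix.of_apply, Matrix.mul_apply, Finset.smul_sum, Finset.sum_mul,
    Finset.mul_sum, Finset.sum_smul, smul_smul]
  calc _ = ∑ a, ∑ i, ∑ j, ∑ b, (γ k a * δ b l * (α a i * β j b)) • v i j := by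
        refine Finset.sum_congr rfl fun a _ => ?_
        rw [Finset.sum_comm]
        exact Finset.sum_congr rfl fun i _ => Finset.sum_comm
    _ = ∑ i, ∑ j, ∑ a, ∑ b, (γ k a * δ b l * (α a i * β j b)) • v i j := by
        rw [Finset.sum_comm]
        exact Finset.sum_congr rfl fun i _ => Finset.sum_comm
    _ = _ := by
        refine Finset.sum_congr rfl fun i _ => Finset.sum_congr rfl fun j _ => ?_
        rw [Finset.sum_comm]
        refine Finset.sum_congr rfl fun a _ => Finset.sum_congr rfl fun b _ => ?_
        congr 1
        ring

lemma cmul_map {W : Type v} [AddCommGroup W] [Module ℂ W] (T : V →ₗ[ℂ] W)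
    (α : Matrix κ ι ℂ) (v : Matrix ι ι V) (β : Matrix ι κ ℂ) :
    (cmul α v β).map T = cmul α (v.map T) β := by
  ext k l
  simp [cmul, map_sum]

end selection

namespace OperatorSpace

/-- Ruan's axioms follow from their inequality versions. -/
@[reducible]
def ofLE {V : Type u} [SeminormedAddCommGroup V] [NormedSpace ℂ V]
    (N : ∀ {ι : Type} [Fintype ι], Matrix ι ι V → ℝ)
    (hnn : ∀ {ι : Type} [Fintype ι] (v : Matrix ι ι V), 0 ≤ N v)
    (hadd : ∀ {ι : Type} [Fintype ι] (v w : Matrix ι ι V), N (v + w) ≤ N v + N w)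
    (hsmul : ∀ {ι : Type} [Fintype ι] (c : ℂ) (v : Matrix ι ι V), N (c • v) ≤ ‖c‖ * N v)
    (hunit : ∀ x : V, N (Matrix.of fun _ _ : Unit => x) = ‖x‖)
    (hblocks : ∀ {ι κ : Type} [Fintype ι] [Fintype κ] (v : Matrix ι ι V) (w : Matrix κ κ V),
      N (Matrix.fromBlocks v 0 0 w) ≤ max (N v) (N w))
    (hcmul : ∀ {ι κ : Type} [Fintype ι] [Fintype κ] (α : Matrix κ ι ℂ) (v : Matrix ι ι V)
      (β : Matrix ι κ ℂ), N (cmul α v β) ≤ opNorm α * N v * opNorm β) : OperatorSpace V where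
  mnorm := N
  mnorm_add_le := hadd
  mnorm_smul c v := by
    refine le_antisymm (hsmul c v) ?_
    rcases eq_or_ne c 0 with rfl | hc
    · simpa using hnn (0 : Matrix _ _ V)
    · have h := hsmul c⁻¹ (c • v)
      rw [smul_smul, inv_mul_cancel₀ hc, one_smul, norm_inv] at h
      have hc' : 0 < ‖c‖ := norm_pos_iff.2 hc
      calc ‖c‖ * N v ≤ ‖c‖ * (‖c‖⁻¹ * N (c • v)) := by gcongr
        _ = N (c • v) := by field_simp
  mnorm_unit := hunit
  mnorm_fromBlocks v w := by
    refine le_antisymm (hblocks v w) ?_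
    have key : ∀ {ι κ : Type} [Fintype ι] [Fintype κ] (u : Matrix ι ι V) (f : κ → ι),
        Function.Injective f → N (u.submatrix f f) ≤ N u := by
      intro ι κ _ _ u f hf
      rw [← cmul_sel']
      refine (hcmul _ _ _).trans ?_
      have := mul_le_mul (mul_le_mul_of_nonneg_right (opNorm_sel_le f hf) (hnn u))
        (opNorm_sel_transpose_le f hf) (opNorm_nonneg _) (by simpa using hnn u)
      simpa using this
    exact max_le (key (Matrix.fromBlocks v 0 0 w) Sum.inl Sum.inl_injective)
      (key (Matrix.fromBlocks v 0 0 w) Sum.inr Sum.inr_injective)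
  mnorm_cmul_le := hcmul

variable {V : Type u} [SeminormedAddCommGroup V] [NormedSpace ℂ V] [OperatorSpace V]
variable {ι κ : Type} [Fintype ι] [Fintype κ]

lemma mnorm_zero : mnorm (0 : Matrix ι ι V) = 0 := by
  simpa using mnorm_smul (0 : ℂ) (0 : Matrix ι ι V)

lemma mnorm_neg (v : Matrix ι ι V) : mnorm (-v) = mnorm v := by
  simpa using mnorm_smul (-1 : ℂ) v

lemma mnorm_nonneg (v : Matrix ι ι V) : 0 ≤ mnorm v := by
  have h := mnorm_add_le v (-v)
  rw [add_neg_cancel, mnorm_zero, mnorm_neg] at h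
  linarith

lemma mnorm_sum_le {σ : Type*} (s : Finset σ) (f : σ → Matrix ι ι V) :
    mnorm (∑ a ∈ s, f a) ≤ ∑ a ∈ s, mnorm (f a) :=
  Finset.le_sum_of_subadditive _ mnorm_zero.le mnorm_add_le _ _

lemma mnorm_submatrix_le (v : Matrix ι ι V) (f g : κ → ι) (hf : Function.Injective f)
    (hg : Function.Injective g) : mnorm (Matrix.of fun k l => v (f k) (g l)) ≤ mnorm v := by
  rw [← cmul_sel]
  refine (mnorm_cmul_le _ _ _).trans ?_
  have := mul_le_mul (mul_le_mul_of_nonneg_right (opNorm_sel_le f hf) (mnorm_nonneg v))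
    (opNorm_sel_transpose_le g hg) (opNorm_nonneg _) (by simpa using mnorm_nonneg v)
  simpa using this

lemma mnorm_reindex (v : Matrix ι ι V) (e : κ ≃ ι) : mnorm (v.submatrix e e) = mnorm v := by
  refine le_antisymm (mnorm_submatrix_le v e e e.injective e.injective) ?_
  have h : v = Matrix.of fun k l => (v.submatrix e e) (e.symm k) (e.symm l) := by
    funext i j
    simp
  conv_lhs => rw [h]
  exact mnorm_submatrix_le (v.submatrix e e) e.symm e.symm e.symm.injective e.symm.injective

lemma norm_entry_le (v : Matrix ι ι V) (i j : ι) : ‖v i j‖ ≤ mnorm v := by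
  rw [← mnorm_unit]
  exact mnorm_submatrix_le v (fun _ : Unit => i) (fun _ : Unit => j)
    (fun _ _ _ => rfl) (fun _ _ _ => rfl)

lemma mnorm_le_sum (v : Matrix ι ι V) : mnorm v ≤ ∑ i, ∑ j, ‖v i j‖ := by
  classical
  have hv : v = ∑ i, ∑ j, cmul (sel fun _ : Unit => i).transpose
      (Matrix.of fun _ _ : Unit => v i j) (sel fun _ : Unit => j) := by
    ext a b
    simp [Matrix.sum_apply, cmul, sel_apply]
  conv_lhs => rw [hv]
  refine (mnorm_sum_le _ _).trans (Finset.sum_le_sum fun i _ => ?_)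
  refine (mnorm_sum_le _ _).trans (Finset.sum_le_sum fun j _ => ?_)
  refine (mnorm_cmul_le _ _ _).trans ?_
  rw [mnorm_unit]
  have := mul_le_mul (mul_le_mul_of_nonneg_right
    (opNorm_sel_transpose_le (fun _ : Unit => i) (fun _ _ _ => rfl)) (norm_nonneg (v i j)))
    (opNorm_sel_le (fun _ : Unit => j) (fun _ _ _ => rfl)) (opNorm_nonneg _) (by simp)
  simpa using this

lemma mnorm_sub_abs_le (v w : Matrix ι ι V) :
    |mnorm v - mnorm w| ≤ ∑ i, ∑ j, ‖v i j - w i j‖ := by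
  have h1 := mnorm_add_le (v - w) w
  have h2 := mnorm_add_le (w - v) v
  have h3 : mnorm (w - v) = mnorm (v - w) := by rw [← mnorm_neg, neg_sub]
  have h4 := mnorm_le_sum (v - w)
  simp only [sub_add_cancel, Matrix.sub_apply] at h1 h2 h4
  rw [abs_le]
  constructor <;> linarith

end OperatorSpace

open OperatorSpace

/-! ### Completely bounded maps -/

section cb

variable {V : Type u} [SeminormedAddCommGroup V] [NormedSpace ℂ V] [OperatorSpace V]
variable {W : Type v} [SeminormedAddCommGroup W] [NormedSpace ℂ W] [OperatorSpace W]
variable {X : Type w} [SeminormedAddCommGroup X] [NormedSpace ℂ X] [OperatorSpace X]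

/-- A linear map is completely bounded if its amplifications `M_ι(V) → M_ι(W)` are bounded,
uniformly in `ι`. -/
def CompletelyBounded (T : V →ₗ[ℂ] W) : Prop :=
  ∃ C : ℝ, ∀ (ι : Type) [Fintype ι] (x : Matrix ι ι V), mnorm (x.map T) ≤ C * mnorm x

/-- The amplification `(φ(x_ij, y_kl))` of a bilinear map at two matrices. -/
def amp {V : Type u} {W : Type v} {X : Type w} [AddCommGroup V] [Module ℂ V] [AddCommGroup W]
    [Module ℂ W] [AddCommGroup X] [Module ℂ X] {ι κ : Type} (φ : V →ₗ[ℂ] W →ₗ[ℂ] X)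
    (x : Matrix ι ι V) (y : Matrix κ κ W) : Matrix (ι × κ) (ι × κ) X :=
  Matrix.of fun p q => φ (x p.1 q.1) (y p.2 q.2)

/-- A bilinear map is (jointly) completely bounded if its amplifications
`M_ι(V) × M_κ(W) → M_{ι × κ}(X)` are bounded, uniformly in `ι` and `κ`. -/
def JointlyCB (φ : V →ₗ[ℂ] W →ₗ[ℂ] X) : Prop :=
  ∃ C : ℝ, ∀ (ι κ : Type) [Fintype ι] [Fintype κ] (x : Matrix ι ι V) (y : Matrix κ κ W),
    mnorm (amp φ x y) ≤ C * mnorm x * mnorm y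

end cb
/-! ### The dual operator space -/

section dual

variable {E : Type u} [SeminormedAddCommGroup E] [NormedSpace ℂ E]

/-- The scalar matrix `(φ_ij(x_kl))`. -/
def pair {ι κ : Type} (φ : Matrix ι ι (StrongDual ℂ E)) (x : Matrix κ κ E) :
    Matrix (ι × κ) (ι × κ) ℂ :=
  Matrix.of fun p q => φ p.1 q.1 (x p.2 q.2)

variable [OperatorSpace E]

/-- The norm of `(φ_ij)` in `M_ι(E*) = CB(E, M_ι)`. -/
def dualNorm {ι : Type} [Fintype ι] (φ : Matrix ι ι (StrongDual ℂ E)) : ℝ :=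
  sSup {r : ℝ | ∃ (κ : Type) (_ : Fintype κ) (x : Matrix κ κ E),
    mnorm x ≤ 1 ∧ r = opNorm (pair φ x)}

variable {ι κ : Type} [Fintype ι] [Fintype κ]

lemma opNorm_map_le (f : StrongDual ℂ E) (x : Matrix κ κ E) :
    opNorm (x.map f) ≤ ‖f‖ * mnorm x := by
  have hC : 0 ≤ ‖f‖ * mnorm x := mul_nonneg (norm_nonneg _) (mnorm_nonneg _)
  refine opNorm_le_of _ hC fun ξ => ?_
  set y : κ → ℂ := fun i => ∑ j, x.map f i j * ξ j with hy
  set S : ℝ := ∑ i, ‖y i‖ ^ 2 with hS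
  set T : ℝ := ∑ j, ‖ξ j‖ ^ 2 with hT
  have hS0 : 0 ≤ S := by positivity
  have hT0 : 0 ≤ T := by positivity
  let a : Matrix κ Unit ℂ := Matrix.of fun i _ => y i
  let b : Matrix κ Unit ℂ := Matrix.of fun i _ => ξ i
  have ha : opNorm a ^ 2 = S := sum_sq_column a
  have hb : opNorm b ^ 2 = T := sum_sq_column b
  have h1 : f (cmul a.conjTranspose x b () ()) = (S : ℂ) := by
    simp only [cmul, Matrix.of_apply, map_sum, map_smul, Matrix.conjTranspose_apply, a, b, S]
    push_cast
    refine Finset.sum_congr rfl fun i _ => ?_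
    rw [← Complex.conj_mul', hy]
    simp only [Finset.mul_sum, smul_eq_mul, Matrix.map_apply]
    refine Finset.sum_congr rfl fun j _ => ?_
    simp only [RCLike.star_def]
    ring
  have h2 : S ≤ ‖f‖ * (opNorm a * mnorm x * opNorm b) := by
    have h3 : ‖f (cmul a.conjTranspose x b () ())‖ = S := by
      rw [h1, Complex.norm_real, Real.norm_of_nonneg hS0]
    rw [← h3]
    refine (f.le_opNorm _).trans (mul_le_mul_of_nonneg_left ?_ (norm_nonneg _))
    refine (norm_entry_le _ _ _).trans ((mnorm_cmul_le _ _ _).trans ?_)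
    rw [opNorm_conjTranspose]
  have ha0 := opNorm_nonneg a
  have hb0 := opNorm_nonneg b
  rcases eq_or_lt_of_le ha0 with h0 | h0
  · rw [← ha, ← h0]
    simpa using mul_nonneg (sq_nonneg _) hT0
  · rw [← ha, ← hb, ← mul_pow]
    refine pow_le_pow_left₀ ha0 ?_ 2
    rw [← ha] at h2
    have h4 : opNorm a * opNorm a ≤ opNorm a * (‖f‖ * mnorm x * opNorm b) := by
      calc _ = opNorm a ^ 2 := by ring
        _ ≤ _ := h2
        _ = _ := by ring
    exact le_of_mul_le_mul_left h4 h0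

lemma opNorm_sum_le {ι κ : Type} [Fintype ι] [Fintype κ] {σ : Type*} (s : Finset σ)
    (f : σ → Matrix ι κ ℂ) : opNorm (∑ a ∈ s, f a) ≤ ∑ a ∈ s, opNorm (f a) :=
  Finset.le_sum_of_subadditive _ opNorm_zero.le opNorm_add_le _ _

lemma opNorm_pair_le_sum (φ : Matrix ι ι (StrongDual ℂ E)) (x : Matrix κ κ E) :
    opNorm (pair φ x) ≤ (∑ i, ∑ j, ‖φ i j‖) * mnorm x := by
  classical
  have h : pair φ x = ∑ i, ∑ j, (sel fun k : κ => (i, k)).transpose * (x.map (φ i j)) *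
      (sel fun k : κ => (j, k)) := by
    ext p q
    obtain ⟨i, k⟩ := p
    obtain ⟨j, l⟩ := q
    simp only [pair, Matrix.of_apply, Matrix.sum_apply, Matrix.mul_apply, sel_apply,
      Matrix.transpose_apply, Matrix.map_apply, Prod.mk.injEq, ite_and, mul_ite, mul_one,
      mul_zero, ite_mul, one_mul, zero_mul]
    simp
  rw [h, Finset.sum_mul]
  refine (opNorm_sum_le _ _).trans (Finset.sum_le_sum fun i _ => ?_)
  rw [Finset.sum_mul]
  refine (opNorm_sum_le _ _).trans (Finset.sum_le_sum fun j _ => ?_)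
  have hinj : ∀ i : ι, Function.Injective fun k : κ => (i, k) := fun i a b h => by simpa using h
  have h1 := opNorm_sel_transpose_le _ (hinj i)
  have h2 := opNorm_sel_le _ (hinj j)
  have h3 := opNorm_map_le (φ i j) x
  have h0 := opNorm_nonneg (x.map (φ i j))
  calc _ ≤ opNorm (sel fun k : κ => (i, k)).transpose * opNorm (x.map (φ i j)) *
        opNorm (sel fun k : κ => (j, k)) :=
        (opNorm_mul_le _ _).trans
          (mul_le_mul_of_nonneg_right (opNorm_mul_le _ _) (opNorm_nonneg _))
    _ ≤ 1 * opNorm (x.map (φ i j)) * 1 := by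
        gcongr
        exact opNorm_nonneg _
    _ ≤ _ := by simpa using h3

lemma pair_smul_right (c : ℂ) (φ : Matrix ι ι (StrongDual ℂ E)) (x : Matrix κ κ E) :
    pair φ (c • x) = c • pair φ x := by
  ext; simp [pair]

lemma bddAbove_dualNorm (φ : Matrix ι ι (StrongDual ℂ E)) :
    BddAbove {r : ℝ | ∃ (κ : Type) (_ : Fintype κ) (x : Matrix κ κ E),
      mnorm x ≤ 1 ∧ r = opNorm (pair φ x)} := by
  refine ⟨∑ i, ∑ j, ‖φ i j‖, ?_⟩
  rintro r ⟨κ, _, x, hx, rfl⟩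
  refine (opNorm_pair_le_sum φ x).trans ?_
  have : 0 ≤ ∑ i, ∑ j, ‖φ i j‖ := by positivity
  simpa using mul_le_mul_of_nonneg_left hx this

lemma dualNorm_nonneg (φ : Matrix ι ι (StrongDual ℂ E)) : 0 ≤ dualNorm φ := by
  refine Real.sSup_nonneg ?_
  rintro r ⟨κ, _, x, hx, rfl⟩
  exact opNorm_nonneg _

lemma opNorm_pair_le (φ : Matrix ι ι (StrongDual ℂ E)) (x : Matrix κ κ E) :
    opNorm (pair φ x) ≤ dualNorm φ * mnorm x := by
  rcases eq_or_lt_of_le (mnorm_nonneg x) with h0 | h0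
  · have := opNorm_pair_le_sum φ x
    rw [← h0, mul_zero] at this ⊢
    exact this
  · have h : opNorm (pair φ (((mnorm x)⁻¹ : ℂ) • x)) ≤ dualNorm φ := by
      refine le_csSup (bddAbove_dualNorm φ) ⟨κ, inferInstance, _, ?_, rfl⟩
      rw [mnorm_smul, norm_inv, Complex.norm_real, Real.norm_of_nonneg h0.le,
        inv_mul_cancel₀ h0.ne']
    rw [pair_smul_right, opNorm_smul, norm_inv, Complex.norm_real, Real.norm_of_nonneg h0.le,
      inv_mul_le_iff₀ h0] at h
    rwa [mul_comm]

lemma dualNorm_le (φ : Matrix ι ι (StrongDual ℂ E)) {C : ℝ} (hC : 0 ≤ C)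
    (h : ∀ (κ : Type) [Fintype κ] (x : Matrix κ κ E), opNorm (pair φ x) ≤ C * mnorm x) :
    dualNorm φ ≤ C := by
  refine Real.sSup_le ?_ hC
  rintro r ⟨κ, _, x, hx, rfl⟩
  exact (h κ x).trans (by simpa using mul_le_mul_of_nonneg_left hx hC)

/-- The dual `E*` of an operator space, with `M_ι(E*) = CB(E, M_ι)`. -/
instance instOperatorSpaceDual : OperatorSpace (StrongDual ℂ E) :=
  OperatorSpace.ofLE (fun {_} _ φ => dualNorm φ)
    (fun φ => dualNorm_nonneg φ)
    (fun φ ψ => by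
      refine dualNorm_le _ (add_nonneg (dualNorm_nonneg _) (dualNorm_nonneg _)) fun κ _ x => ?_
      have : pair (φ + ψ) x = pair φ x + pair ψ x := by ext; simp [pair]
      rw [this, add_mul]
      exact (opNorm_add_le _ _).trans (add_le_add (opNorm_pair_le _ _) (opNorm_pair_le _ _)))
    (fun c φ => by
      refine dualNorm_le _ (mul_nonneg (norm_nonneg _) (dualNorm_nonneg _)) fun κ _ x => ?_
      have : pair (c • φ) x = c • pair φ x := by ext; simp [pair]
      rw [this, opNorm_smul, mul_assoc]
      exact mul_le_mul_of_nonneg_left (opNorm_pair_le _ _) (norm_nonneg _))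
    (fun f => by
      apply le_antisymm
      · refine dualNorm_le _ (norm_nonneg _) fun κ _ x => ?_
        refine le_trans ?_ (opNorm_map_le f x)
        exact opNorm_submatrix_equiv (x.map f) (Equiv.punitProd κ) (Equiv.punitProd κ)
      · refine ContinuousLinearMap.opNorm_le_bound _ (dualNorm_nonneg _) fun x => ?_
        have h := opNorm_pair_le (Matrix.of fun _ _ : Unit => f) (Matrix.of fun _ _ : Unit => x)
        rw [mnorm_unit] at h
        exact (norm_entry_le_opNorm (pair (Matrix.of fun _ _ : Unit => f)
          (Matrix.of fun _ _ : Unit => x)) ((), ()) ((), ())).trans h)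
    (fun {ι ι'} _ _ φ ψ => by
      refine dualNorm_le _ ((dualNorm_nonneg φ).trans (le_max_left _ _)) fun κ _ x => ?_
      have h : pair (Matrix.fromBlocks φ 0 0 ψ) x =
          (Matrix.fromBlocks (pair φ x) 0 0 (pair ψ x)).submatrix (Equiv.sumProdDistrib ι ι' κ)
            (Equiv.sumProdDistrib ι ι' κ) := by
        ext ⟨i | i, k⟩ ⟨j | j, l⟩ <;> simp [pair]
      rw [h]
      refine (opNorm_submatrix_equiv _ _ _).trans ((opNorm_fromBlocks_le _ _).trans ?_)
      rw [max_mul_of_nonneg _ _ (mnorm_nonneg x)]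
      exact max_le_max (opNorm_pair_le _ _) (opNorm_pair_le _ _))
    (fun {ι ι'} _ _ α φ β => by
      classical
      refine dualNorm_le _ (mul_nonneg (mul_nonneg (opNorm_nonneg _) (dualNorm_nonneg _))
        (opNorm_nonneg _)) fun κ _ x => ?_
      have h : pair (cmul α φ β) x = Matrix.kroneckerMap (· * ·) α (1 : Matrix κ κ ℂ) * pair φ x *
          Matrix.kroneckerMap (· * ·) β (1 : Matrix κ κ ℂ) := by
        ext ⟨i, k⟩ ⟨j, l⟩
        simp only [pair, cmul, Matrix.of_apply, Matrix.mul_apply, Matrix.kroneckerMap_apply,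
          Fintype.sum_prod_type, Matrix.one_apply, mul_ite, mul_one, mul_zero, ite_mul, zero_mul,
          Finset.sum_ite_eq, Finset.sum_ite_eq', Finset.mem_univ, if_true,
          _root_.sum_apply, _root_.smul_apply, smul_eq_mul,
          Finset.sum_mul]
        rw [Finset.sum_comm]
        refine Finset.sum_congr rfl fun _ _ => Finset.sum_congr rfl fun _ _ => by ring
      rw [h]
      have h1 := opNorm_amp_le (μ := κ) α
      have h2 := opNorm_amp_le (μ := κ) β
      have h3 := opNorm_pair_le φ x
      calc _ ≤ opNorm (Matrix.kroneckerMap (· * ·) α (1 : Matrix κ κ ℂ)) * opNorm (pair φ x) *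
            opNorm (Matrix.kroneckerMap (· * ·) β (1 : Matrix κ κ ℂ)) :=
            (opNorm_mul_le _ _).trans
              (mul_le_mul_of_nonneg_right (opNorm_mul_le _ _) (opNorm_nonneg _))
        _ ≤ opNorm α * (dualNorm φ * mnorm x) * opNorm β := by
            have := opNorm_nonneg (pair φ x)
            have := opNorm_nonneg α
            have := opNorm_nonneg (Matrix.kroneckerMap (· * ·) β (1 : Matrix κ κ ℂ))
            have := mul_nonneg (dualNorm_nonneg φ) (mnorm_nonneg x)
            gcongr
        _ = _ := by ring)

end dual

/-! ### The completion of an operator space -/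

section completion

open UniformSpace

variable {V : Type u} [SeminormedAddCommGroup V] [NormedSpace ℂ V] [OperatorSpace V]
variable {ι κ : Type} [Fintype ι] [Fintype κ]

/-- The norm on `M_ι` of the completion of `V`: the continuous extension of the norm of `M_ι(V)`,
i.e. `‖x‖ = lim ‖v‖` as `v ∈ M_ι(V)` tends to `x` entrywise. -/
def complNorm (x : Matrix ι ι (Completion V)) : ℝ :=
  limUnder (comap (fun v : Matrix ι ι V => v.map ((↑) : V → Completion V)) (𝓝 x)) mnorm

lemma isUniformInducing_coe_pi :
    IsUniformInducing (fun v : ι → ι → V => fun i j => (v i j : Completion V)) := by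
  have h : Isometry ((↑) : V → Completion V) := Completion.coe_isometry
  have h1 : Isometry (Pi.map (fun _ : ι => Pi.map (fun _ : ι => ((↑) : V → Completion V)))) :=
    Isometry.piMap _ fun _ => Isometry.piMap _ fun _ => h
  exact h1.isUniformInducing

lemma denseRange_coe_pi :
    DenseRange (fun v : ι → ι → V => fun i j => (v i j : Completion V)) := by
  have h : DenseRange ((↑) : V → Completion V) := Completion.denseRange_coe
  exact DenseRange.piMap fun _ => DenseRange.piMap fun _ => h

lemma uniformContinuous_mnorm :
    UniformContinuous (fun v : ι → ι → V => mnorm (Matrix.of v)) := by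
  refine LipschitzWith.uniformContinuous (K := (Fintype.card ι * Fintype.card ι : ℕ)) ?_
  refine LipschitzWith.of_dist_le_mul fun v w => ?_
  rw [Real.dist_eq]
  refine (OperatorSpace.mnorm_sub_abs_le (Matrix.of v) (Matrix.of w)).trans ?_
  calc _ ≤ ∑ _i : ι, ∑ _j : ι, dist v w := by
        refine Finset.sum_le_sum fun i _ => Finset.sum_le_sum fun j _ => ?_
        simp only [Matrix.of_apply]
        rw [← dist_eq_norm]
        exact (dist_le_pi_dist (v i) (w i) j).trans (dist_le_pi_dist v w i)
    _ = _ := by simp; ring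

lemma complNorm_coe (v : Matrix ι ι V) :
    complNorm (v.map ((↑) : V → Completion V)) = mnorm v :=
  uniformly_extend_of_ind isUniformInducing_coe_pi denseRange_coe_pi
    (uniformContinuous_mnorm (V := V) (ι := ι)) v

lemma continuous_complNorm : Continuous (complNorm (V := V) (ι := ι)) :=
  (uniformContinuous_uniformly_extend isUniformInducing_coe_pi denseRange_coe_pi
    (uniformContinuous_mnorm (V := V) (ι := ι))).continuous

lemma denseRange_coe_matrix :
    DenseRange (fun v : Matrix ι ι V => v.map ((↑) : V → Completion V)) := denseRange_coe_pi

lemma continuous_cmul {W : Type v} [SeminormedAddCommGroup W] [NormedSpace ℂ W]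
    (α : Matrix κ ι ℂ) (β : Matrix ι κ ℂ) :
    Continuous fun v : Matrix ι ι W => cmul α v β := by
  refine continuous_matrix fun k l => ?_
  simp only [cmul, Matrix.of_apply]
  exact continuous_finsetSum _ fun i _ => continuous_finsetSum _ fun j _ =>
    (continuous_id.matrix_elem i j).const_smul _

instance instOperatorSpaceCompletion : OperatorSpace (Completion V) :=
  OperatorSpace.ofLE (fun {_} _ x => complNorm x)
    (fun {ι} _ x => by
      refine denseRange_coe_matrix.induction_on x
        (isClosed_le continuous_const continuous_complNorm) fun v => ?_
      rw [complNorm_coe]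
      exact OperatorSpace.mnorm_nonneg v)
    (fun {ι} _ x y => by
      refine denseRange_coe_matrix.induction_on x
        (isClosed_le (continuous_complNorm.comp (continuous_id.add continuous_const))
          (continuous_complNorm.add continuous_const)) fun v => ?_
      refine denseRange_coe_matrix.induction_on y
        (isClosed_le (continuous_complNorm.comp (continuous_const.add continuous_id))
          (continuous_const.add continuous_complNorm)) fun w => ?_
      have h : v.map ((↑) : V → Completion V) + w.map ((↑) : V → Completion V) =
          (v + w).map ((↑) : V → Completion V) := by
        ext i j
        simp only [Matrix.add_apply, Matrix.map_apply, Completion.coe_add]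
      rw [h, complNorm_coe, complNorm_coe, complNorm_coe]
      exact OperatorSpace.mnorm_add_le v w)
    (fun {ι} _ c x => by
      refine denseRange_coe_matrix.induction_on x
        (isClosed_le (continuous_complNorm.comp (continuous_id.const_smul c))
          (continuous_const.mul continuous_complNorm)) fun v => ?_
      have h : c • v.map ((↑) : V → Completion V) = (c • v).map ((↑) : V → Completion V) := by
        ext; simp
      rw [h, complNorm_coe, complNorm_coe, OperatorSpace.mnorm_smul])
    (fun x => by
      refine Completion.denseRange_coe.induction_on x
        (isClosed_eq (continuous_complNorm.comp (continuous_matrix fun _ _ => continuous_id))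
          continuous_norm) fun v => ?_
      rw [Completion.norm_coe, ← OperatorSpace.mnorm_unit, ← complNorm_coe]
      rfl)
    (fun {ι κ} _ _ x y => by
      refine denseRange_coe_matrix.induction_on x
        (isClosed_le (continuous_complNorm.comp (continuous_id.matrix_fromBlocks continuous_const
          continuous_const continuous_const))
          (continuous_complNorm.max continuous_const)) fun v => ?_
      refine denseRange_coe_matrix.induction_on y
        (isClosed_le (continuous_complNorm.comp (continuous_const.matrix_fromBlocks continuous_const
          continuous_const continuous_id))
          (continuous_const.max continuous_complNorm)) fun w => ?_
      have h : Matrix.fromBlocks (v.map ((↑) : V → Completion V)) 0 0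
          (w.map ((↑) : V → Completion V)) =
          (Matrix.fromBlocks v 0 0 w).map ((↑) : V → Completion V) := by
        ext (i | i) (j | j) <;> simp [Completion.coe_zero]
      change complNorm (Matrix.fromBlocks _ 0 0 _) ≤ _
      rw [h, complNorm_coe, complNorm_coe, complNorm_coe, OperatorSpace.mnorm_fromBlocks])
    (fun {ι κ} _ _ α x β => by
      refine denseRange_coe_matrix.induction_on x
        (isClosed_le (continuous_complNorm.comp (continuous_cmul α β))
          ((continuous_const.mul continuous_complNorm).mul continuous_const)) fun v => ?_
      have h : cmul α (v.map ((↑) : V → Completion V)) β =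
          (cmul α v β).map ((↑) : V → Completion V) :=
        (cmul_map (Completion.toComplL (𝕜 := ℂ) (E := V)).toLinearMap α v β).symm
      rw [h, complNorm_coe, complNorm_coe]
      exact OperatorSpace.mnorm_cmul_le α v β)

end completion

/-! ### The operator space projective tensor product -/

section projective

/-- The algebraic tensor product of two operator spaces (a copy of `V ⊗[ℂ] W`, which carries the
projective matrix norms). -/
def AlgTensor (V : Type u) (W : Type v) [SeminormedAddCommGroup V] [NormedSpace ℂ V]
    [SeminormedAddCommGroup W] [NormedSpace ℂ W] : Type (max u v) := V ⊗[ℂ] W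

variable {V : Type u} [SeminormedAddCommGroup V] [NormedSpace ℂ V]
variable {W : Type v} [SeminormedAddCommGroup W] [NormedSpace ℂ W]

instance : AddCommGroup (AlgTensor V W) := inferInstanceAs (AddCommGroup (V ⊗[ℂ] W))

instance : Module ℂ (AlgTensor V W) := inferInstanceAs (Module ℂ (V ⊗[ℂ] W))

/-- The canonical bilinear map `(x, y) ↦ x ⊗ y`. -/
def AlgTensor.mk (V : Type u) (W : Type v) [SeminormedAddCommGroup V] [NormedSpace ℂ V]
    [SeminormedAddCommGroup W] [NormedSpace ℂ W] : V →ₗ[ℂ] W →ₗ[ℂ] AlgTensor V W :=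
  TensorProduct.mk ℂ V W

/-- The linear map on the algebraic tensor product given by a bilinear map. -/
def AlgTensor.lift {X : Type w} [AddCommGroup X] [Module ℂ X] (φ : V →ₗ[ℂ] W →ₗ[ℂ] X) :
    AlgTensor V W →ₗ[ℂ] X :=
  TensorProduct.lift φ

lemma AlgTensor.lift_mk {X : Type w} [AddCommGroup X] [Module ℂ X] (φ : V →ₗ[ℂ] W →ₗ[ℂ] X)
    (x : V) (y : W) : AlgTensor.lift φ (AlgTensor.mk V W x y) = φ x y :=
  TensorProduct.lift.tmul x y

variable [OperatorSpace V] [OperatorSpace W]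
variable {ι κ : Type} [Fintype ι] [Fintype κ]

/-- The projective matrix norm on `M_ι(V ⊗ W)`:
`‖u‖ = inf {‖α‖ ‖x‖ ‖y‖ ‖β‖ : u = α (x ⊗ y) β}`, where `x ∈ M_κ(V)`, `y ∈ M_μ(W)`,
and `α`, `β` are scalar matrices of sizes `ι × (κ × μ)` and `(κ × μ) × ι`. -/
def projNorm (u : Matrix ι ι (AlgTensor V W)) : ℝ :=
  sInf {r : ℝ | ∃ (κ μ : Type) (_ : Fintype κ) (_ : Fintype μ) (α : Matrix ι (κ × μ) ℂ)
    (x : Matrix κ κ V) (y : Matrix μ μ W) (β : Matrix (κ × μ) ι ℂ),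
    u = cmul α (amp (AlgTensor.mk V W) x y) β ∧ r = opNorm α * mnorm x * mnorm y * opNorm β}

lemma bddBelow_projNorm (u : Matrix ι ι (AlgTensor V W)) :
    BddBelow {r : ℝ | ∃ (κ μ : Type) (_ : Fintype κ) (_ : Fintype μ) (α : Matrix ι (κ × μ) ℂ)
    (x : Matrix κ κ V) (y : Matrix μ μ W) (β : Matrix (κ × μ) ι ℂ),
    u = cmul α (amp (AlgTensor.mk V W) x y) β ∧
      r = opNorm α * mnorm x * mnorm y * opNorm β} := by
  refine ⟨0, ?_⟩
  rintro r ⟨κ, μ, _, _, α, x, y, β, -, rfl⟩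
  exact mul_nonneg (mul_nonneg (mul_nonneg (opNorm_nonneg _) (mnorm_nonneg _)) (mnorm_nonneg _))
    (opNorm_nonneg _)

lemma projNorm_nonneg (u : Matrix ι ι (AlgTensor V W)) : 0 ≤ projNorm u := by
  refine Real.sInf_nonneg ?_
  rintro r ⟨κ, μ, _, _, α, x, y, β, -, rfl⟩
  exact mul_nonneg (mul_nonneg (mul_nonneg (opNorm_nonneg _) (mnorm_nonneg _)) (mnorm_nonneg _))
    (opNorm_nonneg _)

lemma projNorm_cmul_amp_le {μ : Type} [Fintype μ] (α : Matrix ι (κ × μ) ℂ)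
    (x : Matrix κ κ V) (y : Matrix μ μ W) (β : Matrix (κ × μ) ι ℂ) :
    projNorm (cmul α (amp (AlgTensor.mk V W) x y) β) ≤
      opNorm α * mnorm x * mnorm y * opNorm β :=
  csInf_le (bddBelow_projNorm _) ⟨κ, μ, inferInstance, inferInstance, α, x, y, β, rfl, rfl⟩

lemma cmul_fromBlocks {U : Type u} [AddCommGroup U] [Module ℂ U] {ι κ ι' κ' : Type} [Fintype ι]
    [Fintype ι'] (α : Matrix κ ι ℂ) (x : Matrix ι ι U) (β : Matrix ι κ ℂ)
    (α' : Matrix κ' ι' ℂ) (y : Matrix ι' ι' U) (β' : Matrix ι' κ' ℂ) :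
    cmul (Matrix.fromBlocks α 0 0 α') (Matrix.fromBlocks x 0 0 y) (Matrix.fromBlocks β 0 0 β') =
      Matrix.fromBlocks (cmul α x β) 0 0 (cmul α' y β') := by
  ext (k | k) (l | l) <;> simp [cmul]

/-- The inclusion of index sets matching `(x ⊗ y) ⊕ (x' ⊗ y')` with a corner of
`(x ⊕ x') ⊗ (y ⊕ y')`. -/
def cornerMap (κ μ κ' μ' : Type) : (κ × μ) ⊕ (κ' × μ') → (κ ⊕ κ') × (μ ⊕ μ') :=
  Sum.elim (Prod.map Sum.inl Sum.inl) (Prod.map Sum.inr Sum.inr)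

lemma cornerMap_injective (κ μ κ' μ' : Type) : Function.Injective (cornerMap κ μ κ' μ') := by
  rintro (⟨a, b⟩ | ⟨a, b⟩) (⟨c, d⟩ | ⟨c, d⟩) h <;> simp [cornerMap] at h ⊢ <;> exact h

lemma fromBlocks_amp {μ κ' μ' : Type} (x : Matrix κ κ V) (y : Matrix μ μ W)
    (x' : Matrix κ' κ' V) (y' : Matrix μ' μ' W) :
    Matrix.fromBlocks (amp (AlgTensor.mk V W) x y) 0 0 (amp (AlgTensor.mk V W) x' y') =
      (amp (AlgTensor.mk V W) (Matrix.fromBlocks x 0 0 x')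
        (Matrix.fromBlocks y 0 0 y')).submatrix (cornerMap κ μ κ' μ') (cornerMap κ μ κ' μ') := by
  ext (⟨a, b⟩ | ⟨a, b⟩) (⟨c, d⟩ | ⟨c, d⟩) <;> simp [amp, cornerMap]

lemma fromBlocks_rep {ι' μ κ' μ' : Type} [Fintype ι'] [Fintype μ] [Fintype κ'] [Fintype μ']
    (α : Matrix ι (κ × μ) ℂ) (x : Matrix κ κ V) (y : Matrix μ μ W) (β : Matrix (κ × μ) ι ℂ)
    (α' : Matrix ι' (κ' × μ') ℂ) (x' : Matrix κ' κ' V) (y' : Matrix μ' μ' W)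
    (β' : Matrix (κ' × μ') ι' ℂ) :
    Matrix.fromBlocks (cmul α (amp (AlgTensor.mk V W) x y) β) 0 0
      (cmul α' (amp (AlgTensor.mk V W) x' y') β') =
    cmul (Matrix.fromBlocks α 0 0 α' * sel (cornerMap κ μ κ' μ'))
      (amp (AlgTensor.mk V W) (Matrix.fromBlocks x 0 0 x') (Matrix.fromBlocks y 0 0 y'))
      ((sel (cornerMap κ μ κ' μ')).transpose * Matrix.fromBlocks β 0 0 β') := by
  rw [← cmul_cmul, cmul_sel', ← fromBlocks_amp, cmul_fromBlocks]

/-- The row `(s, t)` of scalar multiples of the identity. -/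
def scalarRow (ι : Type) (s t : ℝ) : Matrix ι (ι ⊕ ι) ℂ :=
  letI := Classical.decEq ι
  Matrix.of fun i => Sum.elim (fun j => if i = j then (s : ℂ) else 0)
    (fun j => if i = j then (t : ℂ) else 0)

lemma opNorm_scalarRow_transpose_le (s t : ℝ) (h : s ^ 2 + t ^ 2 = 1) :
    opNorm (scalarRow ι s t).transpose ≤ 1 := by
  classical
  refine opNorm_le_of _ zero_le_one fun x => ?_
  simp only [Fintype.sum_sum_type, Matrix.transpose_apply, scalarRow, Matrix.of_apply,
    Sum.elim_inl, Sum.elim_inr, ite_mul, zero_mul, Finset.sum_ite_eq', Finset.mem_univ, if_true,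
    norm_mul, mul_pow, Complex.norm_real, Real.norm_eq_abs, sq_abs, ← Finset.mul_sum]
  rw [← add_mul, h]
  simp

lemma opNorm_scalarRow_le (s t : ℝ) (h : s ^ 2 + t ^ 2 = 1) :
    opNorm (scalarRow ι s t) ≤ 1 := by
  have : (scalarRow ι s t) = (scalarRow ι s t).transpose.conjTranspose := by
    ext i (j | j) <;> by_cases hij : i = j <;> simp [scalarRow, Matrix.conjTranspose_apply, hij]
  rw [this, opNorm_conjTranspose]
  exact opNorm_scalarRow_transpose_le s t h

lemma cmul_scalarRow {U : Type u} [AddCommGroup U] [Module ℂ U] (s t : ℝ) (x y : Matrix ι ι U) :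
    cmul (scalarRow ι s t) (Matrix.fromBlocks x 0 0 y) (scalarRow ι s t).transpose =
      ((s : ℂ) ^ 2) • x + ((t : ℂ) ^ 2) • y := by
  classical
  ext k l
  simp [cmul, scalarRow, sq]

lemma exists_rep (u : Matrix ι ι (AlgTensor V W)) :
    ∃ (κ μ : Type) (_ : Fintype κ) (_ : Fintype μ) (α : Matrix ι (κ × μ) ℂ)
    (x : Matrix κ κ V) (y : Matrix μ μ W) (β : Matrix (κ × μ) ι ℂ),
    u = cmul α (amp (AlgTensor.mk V W) x y) β := by
  classical
  let R : ∀ {ι : Type} [Fintype ι], Matrix ι ι (AlgTensor V W) → Prop := fun {ι} _ u =>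
    ∃ (κ μ : Type) (_ : Fintype κ) (_ : Fintype μ) (α : Matrix ι (κ × μ) ℂ)
      (x : Matrix κ κ V) (y : Matrix μ μ W) (β : Matrix (κ × μ) ι ℂ),
      u = cmul α (amp (AlgTensor.mk V W) x y) β
  have hc : ∀ {ι κ : Type} [Fintype ι] [Fintype κ] (α : Matrix κ ι ℂ)
      (u : Matrix ι ι (AlgTensor V W)) (β : Matrix ι κ ℂ), R u → R (cmul α u β) := by
    rintro ι κ _ _ α u β ⟨κ', μ, _, _, α', x, y, β', rfl⟩
    exact ⟨κ', μ, _, _, α * α', x, y, β' * β, cmul_cmul _ _ _ _ _⟩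
  have hadd : ∀ {ι : Type} [Fintype ι] (u v : Matrix ι ι (AlgTensor V W)), R u → R v →
      R (u + v) := by
    rintro ι _ u v ⟨κ, μ, _, _, α, x, y, β, rfl⟩ ⟨κ', μ', _, _, α', x', y', β', rfl⟩
    have h : ∀ u v : Matrix ι ι (AlgTensor V W), u + v =
        cmul (Matrix.of fun i => Sum.elim (fun j => if i = j then 1 else 0)
          (fun j => if i = j then 1 else 0)) (Matrix.fromBlocks u 0 0 v)
          (Matrix.of fun i => Sum.elim (fun j => if i = j then 1 else 0)
          (fun j => if i = j then 1 else 0)).transpose := by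
      intro u v
      ext k l
      simp [cmul]
    rw [h]
    refine hc _ _ _ ?_
    rw [fromBlocks_rep]
    exact ⟨_, _, _, _, _, _, _, _, rfl⟩
  have hzero : ∀ {ι : Type} [Fintype ι], R (0 : Matrix ι ι (AlgTensor V W)) := by
    intro ι _
    refine ⟨Unit, Unit, inferInstance, inferInstance, 0, 0, 0, 0, ?_⟩
    ext k l
    simp [cmul]
  have hsum : ∀ {ι : Type} [Fintype ι] (s : Finset ι) (f : ι → Matrix ι ι (AlgTensor V W)),
      (∀ a, R (f a)) → R (∑ a ∈ s, f a) := by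
    intro ι _ s f hf
    induction s using Finset.induction_on with
    | empty => simpa using hzero
    | insert a s ha ih => rw [Finset.sum_insert ha]; exact hadd _ _ (hf a) ih
  have hunit : ∀ t : AlgTensor V W, R (Matrix.of fun _ _ : Unit => t) := by
    intro t
    refine TensorProduct.induction_on (motive := fun t : V ⊗[ℂ] W =>
      R (Matrix.of fun _ _ : Unit => (t : AlgTensor V W))) t ?_ ?_ ?_
    · exact hzero
    · intro x y
      refine ⟨Unit, Unit, inferInstance, inferInstance, sel fun _ => ((), ()),
        Matrix.of fun _ _ => x, Matrix.of fun _ _ => y, (sel fun _ => ((), ())).transpose, ?_⟩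
      rw [cmul_sel']
      rfl
    · intro a b ha hb
      exact hadd _ _ ha hb
  have hv : u = ∑ i, ∑ j, cmul (sel fun _ : Unit => i).transpose
      (Matrix.of fun _ _ : Unit => u i j) (sel fun _ : Unit => j) := by
    ext a b
    simp [Matrix.sum_apply, cmul, sel_apply]
  have : R u := by
    rw [hv]
    exact hsum _ _ fun i => hsum _ _ fun j => hc _ _ _ (hunit _)
  exact this

lemma exists_rep_lt (u : Matrix ι ι (AlgTensor V W)) {R : ℝ} (h : projNorm u < R) :
    ∃ (κ μ : Type) (_ : Fintype κ) (_ : Fintype μ) (α : Matrix ι (κ × μ) ℂ)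
    (x : Matrix κ κ V) (y : Matrix μ μ W) (β : Matrix (κ × μ) ι ℂ),
    u = cmul α (amp (AlgTensor.mk V W) x y) β ∧
      opNorm α * mnorm x * mnorm y * opNorm β < R := by
  obtain ⟨κ, μ, i1, i2, α, x, y, β, hu⟩ := exists_rep u
  have hne : {r : ℝ | ∃ (κ μ : Type) (_ : Fintype κ) (_ : Fintype μ) (α : Matrix ι (κ × μ) ℂ)
      (x : Matrix κ κ V) (y : Matrix μ μ W) (β : Matrix (κ × μ) ι ℂ),
      u = cmul α (amp (AlgTensor.mk V W) x y) β ∧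
        r = opNorm α * mnorm x * mnorm y * opNorm β}.Nonempty :=
    ⟨_, κ, μ, i1, i2, α, x, y, β, hu, rfl⟩
  obtain ⟨r, ⟨κ, μ, i1, i2, α, x, y, β, hu, rfl⟩, hr⟩ := exists_lt_of_csInf_lt hne h
  exact ⟨κ, μ, i1, i2, α, x, y, β, hu, hr⟩

lemma cmul_smul_mid {U : Type u} [AddCommGroup U] [Module ℂ U] (a b c : ℂ) (α : Matrix ι κ ℂ)
    (x : Matrix κ κ U) (β : Matrix κ ι ℂ) :
    cmul (a • α) (b • x) (c • β) = (a * b * c) • cmul α x β := by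
  ext k l
  simp only [cmul, Matrix.of_apply, Matrix.smul_apply, smul_eq_mul, Finset.smul_sum, smul_smul]
  refine Finset.sum_congr rfl fun _ _ => Finset.sum_congr rfl fun _ _ => ?_
  congr 1
  ring

lemma amp_smul {μ : Type} (a b : ℂ) (x : Matrix κ κ V) (y : Matrix μ μ W) :
    amp (AlgTensor.mk V W) (a • x) (b • y) = (a * b) • amp (AlgTensor.mk V W) x y := by
  ext p q
  simp [amp, smul_smul, mul_comm]

/-- Normalized representations. -/
lemma exists_rep_normalized (u : Matrix ι ι (AlgTensor V W)) {R : ℝ} (h : projNorm u < R) :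
    ∃ (κ μ : Type) (_ : Fintype κ) (_ : Fintype μ) (α : Matrix ι (κ × μ) ℂ)
    (x : Matrix κ κ V) (y : Matrix μ μ W) (β : Matrix (κ × μ) ι ℂ),
    u = cmul α (amp (AlgTensor.mk V W) x y) β ∧
      opNorm α ≤ R ∧ mnorm x ≤ 1 ∧ mnorm y ≤ 1 ∧ opNorm β ≤ 1 := by
  have hR : 0 < R := (projNorm_nonneg u).trans_lt h
  obtain ⟨κ, μ, i1, i2, α, x, y, β, hu, hlt⟩ := exists_rep_lt u h
  have hcont : Continuous fun d : ℝ =>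
      (opNorm α + d) * (mnorm x + d) * (mnorm y + d) * (opNorm β + d) := by fun_prop
  have hev : ∀ᶠ d in 𝓝[>] (0 : ℝ),
      (opNorm α + d) * (mnorm x + d) * (mnorm y + d) * (opNorm β + d) < R := by
    have := hcont.tendsto 0
    simp only [add_zero] at this
    exact (this.eventually (gt_mem_nhds hlt)).filter_mono nhdsWithin_le_nhds
  obtain ⟨d, hd, hd0⟩ := (hev.and self_mem_nhdsWithin).exists
  have hd0 : 0 < d := hd0
  have hα := opNorm_nonneg α
  have hβ := opNorm_nonneg β
  have hx := mnorm_nonneg x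
  have hy := mnorm_nonneg y
  set b := mnorm x + d with hb
  set c := mnorm y + d with hc
  set e := opNorm β + d with he
  have hb0 : 0 < b := by positivity
  have hc0 : 0 < c := by positivity
  have he0 : 0 < e := by positivity
  refine ⟨κ, μ, i1, i2, ((b * c * e : ℝ) : ℂ) • α, ((b⁻¹ : ℝ) : ℂ) • x, ((c⁻¹ : ℝ) : ℂ) • y,
    ((e⁻¹ : ℝ) : ℂ) • β, ?_, ?_, ?_, ?_, ?_⟩
  · rw [amp_smul, cmul_smul_mid, hu]
    have : (((b * c * e : ℝ) : ℂ) * (((b⁻¹ : ℝ) : ℂ) * ((c⁻¹ : ℝ) : ℂ)) * ((e⁻¹ : ℝ) : ℂ)) = 1 := by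
      norm_cast
      field_simp
    rw [this, one_smul]
  · rw [opNorm_smul, Complex.norm_real, Real.norm_of_nonneg (by positivity)]
    calc b * c * e * opNorm α ≤ b * c * e * (opNorm α + d) := by gcongr; linarith
      _ = (opNorm α + d) * b * c * e := by ring
      _ ≤ R := hd.le
  · rw [OperatorSpace.mnorm_smul, Complex.norm_real, Real.norm_of_nonneg (by positivity),
      inv_mul_le_iff₀ hb0]
    linarith
  · rw [OperatorSpace.mnorm_smul, Complex.norm_real, Real.norm_of_nonneg (by positivity),
      inv_mul_le_iff₀ hc0]
    linarith
  · rw [opNorm_smul, Complex.norm_real, Real.norm_of_nonneg (by positivity),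
      inv_mul_le_iff₀ he0]
    linarith

lemma projNorm_cmul_le (α : Matrix κ ι ℂ) (u : Matrix ι ι (AlgTensor V W)) (β : Matrix ι κ ℂ) :
    projNorm (cmul α u β) ≤ opNorm α * projNorm u * opNorm β := by
  have hα := opNorm_nonneg α
  have hβ := opNorm_nonneg β
  have key : ∀ R : ℝ, projNorm u < R → projNorm (cmul α u β) ≤ opNorm α * R * opNorm β := by
    intro R hR
    obtain ⟨κ', μ, _, _, α', x, y, β', rfl, hlt⟩ := exists_rep_lt u hR
    rw [cmul_cmul]
    refine (projNorm_cmul_amp_le _ _ _ _).trans ?_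
    have h1 := opNorm_mul_le α α'
    have h2 := opNorm_mul_le β' β
    have hx := mnorm_nonneg x
    have hy := mnorm_nonneg y
    have h3 := opNorm_nonneg (β' * β)
    have h4 := opNorm_nonneg α'
    calc _ ≤ (opNorm α * opNorm α') * mnorm x * mnorm y * (opNorm β' * opNorm β) := by gcongr
      _ = opNorm α * (opNorm α' * mnorm x * mnorm y * opNorm β') * opNorm β := by ring
      _ ≤ _ := by gcongr
  have hcont : Continuous fun R : ℝ => opNorm α * R * opNorm β := by fun_prop
  refine ge_of_tendsto (x := 𝓝[>] (projNorm u))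
    ((hcont.tendsto (projNorm u)).mono_left nhdsWithin_le_nhds) ?_
  filter_upwards [self_mem_nhdsWithin] with R hR using key R hR

lemma projNorm_fromBlocks_le (u : Matrix ι ι (AlgTensor V W)) (v : Matrix κ κ (AlgTensor V W)) :
    projNorm (Matrix.fromBlocks u 0 0 v) ≤ max (projNorm u) (projNorm v) := by
  refine le_of_forall_gt_imp_ge_of_dense fun R hR => ?_
  obtain ⟨h1, h2⟩ := max_lt_iff.1 hR
  obtain ⟨κ, μ, _, _, α, x, y, β, rfl, hα, hx, hy, hβ⟩ := exists_rep_normalized u h1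
  obtain ⟨κ', μ', _, _, α', x', y', β', rfl, hα', hx', hy', hβ'⟩ := exists_rep_normalized v h2
  have hR0 : 0 ≤ R := (opNorm_nonneg α).trans hα
  rw [fromBlocks_rep]
  refine (projNorm_cmul_amp_le _ _ _ _).trans ?_
  rw [OperatorSpace.mnorm_fromBlocks, OperatorSpace.mnorm_fromBlocks]
  have hinj := cornerMap_injective κ μ κ' μ'
  have e1 : opNorm (Matrix.fromBlocks α 0 0 α' * sel (cornerMap κ μ κ' μ')) ≤ R := by
    refine (opNorm_mul_le _ _).trans ?_
    have := mul_le_mul ((opNorm_fromBlocks_le α α').trans (max_le hα hα'))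
      (opNorm_sel_le _ hinj) (opNorm_nonneg _) hR0
    simpa using this
  have e2 : opNorm ((sel (cornerMap κ μ κ' μ')).transpose * Matrix.fromBlocks β 0 0 β') ≤ 1 := by
    refine (opNorm_mul_le _ _).trans ?_
    have := mul_le_mul (opNorm_sel_transpose_le _ hinj)
      ((opNorm_fromBlocks_le β β').trans (max_le hβ hβ')) (opNorm_nonneg _) zero_le_one
    simpa using this
  have hx0 : 0 ≤ max (mnorm x) (mnorm x') := (mnorm_nonneg x).trans (le_max_left _ _)
  have hy0 : 0 ≤ max (mnorm y) (mnorm y') := (mnorm_nonneg y).trans (le_max_left _ _)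
  calc _ ≤ R * 1 * 1 * 1 := by
        refine mul_le_mul (mul_le_mul (mul_le_mul e1 (max_le hx hx') hx0 hR0) (max_le hy hy') hy0
          (by simpa using hR0)) e2 (opNorm_nonneg _) (by simpa using hR0)
    _ = R := by ring

lemma projNorm_smul_le (c : ℂ) (u : Matrix ι ι (AlgTensor V W)) :
    projNorm (c • u) ≤ ‖c‖ * projNorm u := by
  classical
  have h : c • u = cmul (c • (1 : Matrix ι ι ℂ)) u 1 := by
    ext k l
    simp [cmul, Matrix.one_apply]
  rw [h]
  refine (projNorm_cmul_le _ _ _).trans ?_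
  rw [opNorm_smul]
  have h1 := opNorm_one_le (ι := ι)
  have h0 := opNorm_nonneg (1 : Matrix ι ι ℂ)
  have hu := projNorm_nonneg u
  calc _ ≤ ‖c‖ * 1 * projNorm u * 1 := by gcongr
    _ = _ := by ring

lemma projNorm_add_le (u v : Matrix ι ι (AlgTensor V W)) :
    projNorm (u + v) ≤ projNorm u + projNorm v := by
  have hu := projNorm_nonneg u
  have hv := projNorm_nonneg v
  refine le_of_forall_pos_le_add fun ε hε => ?_
  set a := projNorm u + ε / 2 with ha
  set b := projNorm v + ε / 2 with hb
  have ha0 : 0 < a := by positivity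
  have hb0 : 0 < b := by positivity
  have hs : √(a / (a + b)) ^ 2 = a / (a + b) := Real.sq_sqrt (by positivity)
  have ht : √(b / (a + b)) ^ 2 = b / (a + b) := Real.sq_sqrt (by positivity)
  have hst : √(a / (a + b)) ^ 2 + √(b / (a + b)) ^ 2 = 1 := by
    rw [hs, ht]; field_simp
  have hdec : u + v = cmul (scalarRow ι √(a / (a + b)) √(b / (a + b)))
      (Matrix.fromBlocks ((((a + b) / a : ℝ) : ℂ) • u) 0 0 ((((a + b) / b : ℝ) : ℂ) • v))
      (scalarRow ι √(a / (a + b)) √(b / (a + b))).transpose := by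
    rw [cmul_scalarRow, smul_smul, smul_smul]
    norm_cast
    rw [hs, ht]
    have e1 : a / (a + b) * ((a + b) / a) = 1 := by field_simp
    have e2 : b / (a + b) * ((a + b) / b) = 1 := by field_simp
    rw [e1, e2]
    simp
  rw [hdec]
  refine (projNorm_cmul_le _ _ _).trans ?_
  have h1 := opNorm_scalarRow_le (ι := ι) _ _ hst
  have h2 := opNorm_scalarRow_transpose_le (ι := ι) _ _ hst
  have h3 : projNorm (Matrix.fromBlocks ((((a + b) / a : ℝ) : ℂ) • u) 0 0
      ((((a + b) / b : ℝ) : ℂ) • v)) ≤ a + b := by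
    refine (projNorm_fromBlocks_le _ _).trans (max_le ?_ ?_)
    · refine (projNorm_smul_le _ _).trans ?_
      rw [Complex.norm_real, Real.norm_of_nonneg (by positivity)]
      calc (a + b) / a * projNorm u ≤ (a + b) / a * a := by gcongr; linarith
        _ = a + b := by field_simp
    · refine (projNorm_smul_le _ _).trans ?_
      rw [Complex.norm_real, Real.norm_of_nonneg (by positivity)]
      calc (a + b) / b * projNorm v ≤ (a + b) / b * b := by gcongr; linarith
        _ = a + b := by field_simp
  have h0 := projNorm_nonneg (Matrix.fromBlocks ((((a + b) / a : ℝ) : ℂ) • u) 0 0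
      ((((a + b) / b : ℝ) : ℂ) • v))
  have := mul_le_mul (mul_le_mul h1 h3 h0 zero_le_one) h2 (opNorm_nonneg _) (by positivity)
  refine this.trans (le_of_eq ?_)
  rw [ha, hb]
  ring

instance : Norm (AlgTensor V W) := ⟨fun u => projNorm (Matrix.of fun _ _ : Unit => u)⟩

lemma AlgTensor.core : SeminormedSpace.Core ℂ (AlgTensor V W) where
  norm_nonneg u := projNorm_nonneg _
  norm_smul c u := by
    have h : ∀ (c : ℂ) (u : AlgTensor V W), ‖c • u‖ ≤ ‖c‖ * ‖u‖ := fun c u =>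
      projNorm_smul_le c (Matrix.of fun _ _ : Unit => u)
    refine le_antisymm (h c u) ?_
    rcases eq_or_ne c 0 with rfl | hc
    · rw [norm_zero, zero_mul]
      exact projNorm_nonneg _
    · have h' := h c⁻¹ (c • u)
      rw [smul_smul, inv_mul_cancel₀ hc, one_smul, norm_inv] at h'
      have hc' : 0 < ‖c‖ := norm_pos_iff.2 hc
      calc ‖c‖ * ‖u‖ ≤ ‖c‖ * (‖c‖⁻¹ * ‖c • u‖) := by gcongr
        _ = ‖c • u‖ := by field_simp
  norm_triangle u v := projNorm_add_le (Matrix.of fun _ _ : Unit => u)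
    (Matrix.of fun _ _ : Unit => v)

instance : SeminormedAddCommGroup (AlgTensor V W) := SeminormedAddCommGroup.ofCore AlgTensor.core

instance : NormedSpace ℂ (AlgTensor V W) where
  norm_smul_le c u := (AlgTensor.core.norm_smul c u).le

instance instOperatorSpaceAlgTensor : OperatorSpace (AlgTensor V W) :=
  OperatorSpace.ofLE (fun {_} _ u => projNorm u) projNorm_nonneg projNorm_add_le projNorm_smul_le
    (fun _ => rfl) projNorm_fromBlocks_le projNorm_cmul_le

end projective

section projectiveCompletion

open UniformSpace

variable {V : Type u} [SeminormedAddCommGroup V] [NormedSpace ℂ V] [OperatorSpace V]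
variable {W : Type v} [SeminormedAddCommGroup W] [NormedSpace ℂ W] [OperatorSpace W]
variable {X : Type w} [SeminormedAddCommGroup X] [NormedSpace ℂ X] [OperatorSpace X]

/-- The operator space projective tensor product `V ⊗̂ W`: the completion of the algebraic tensor
product with respect to the projective matrix norms. -/
abbrev ProjTensor (V : Type u) (W : Type v) [SeminormedAddCommGroup V] [NormedSpace ℂ V]
    [OperatorSpace V] [SeminormedAddCommGroup W] [NormedSpace ℂ W] [OperatorSpace W] :
    Type (max u v) :=
  Completion (AlgTensor V W)

/-- The canonical bilinear map `V × W → V ⊗̂ W`. -/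
def ProjTensor.mk (V : Type u) (W : Type v) [SeminormedAddCommGroup V] [NormedSpace ℂ V]
    [OperatorSpace V] [SeminormedAddCommGroup W] [NormedSpace ℂ W] [OperatorSpace W] :
    V →ₗ[ℂ] W →ₗ[ℂ] ProjTensor V W :=
  (AlgTensor.mk V W).compr₂ (Completion.toComplL (𝕜 := ℂ) (E := AlgTensor V W)).toLinearMap

lemma ProjTensor.mk_apply (x : V) (y : W) :
    ProjTensor.mk V W x y = (AlgTensor.mk V W x y : ProjTensor V W) := rfl

lemma jointlyCB_mk : JointlyCB (ProjTensor.mk V W) := by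
  classical
  refine ⟨1, fun ι κ _ _ x y => ?_⟩
  have h : amp (ProjTensor.mk V W) x y =
      (amp (AlgTensor.mk V W) x y).map ((↑) : AlgTensor V W → ProjTensor V W) := rfl
  rw [h]
  refine (complNorm_coe (amp (AlgTensor.mk V W) x y)).le.trans ?_
  have h1 : amp (AlgTensor.mk V W) x y = cmul 1 (amp (AlgTensor.mk V W) x y) 1 := by
    ext k l
    simp [cmul, Matrix.one_apply]
  change projNorm (amp (AlgTensor.mk V W) x y) ≤ _
  rw [h1]
  refine (projNorm_cmul_amp_le _ _ _ _).trans ?_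
  have hx := mnorm_nonneg x
  have hy := mnorm_nonneg y
  have h2 := opNorm_one_le (ι := ι × κ)
  have h3 := opNorm_nonneg (1 : Matrix (ι × κ) (ι × κ) ℂ)
  calc _ ≤ 1 * mnorm x * mnorm y * 1 := by gcongr
    _ = _ := by ring

lemma JointlyCB.exists_bound {φ : V →ₗ[ℂ] W →ₗ[ℂ] X} (h : JointlyCB φ) :
    ∃ C : ℝ, 0 ≤ C ∧ ∀ (ι κ : Type) [Fintype ι] [Fintype κ] (x : Matrix ι ι V)
      (y : Matrix κ κ W), mnorm (amp φ x y) ≤ C * mnorm x * mnorm y := by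
  obtain ⟨C, hC⟩ := h
  refine ⟨max C 0, le_max_right _ _, fun ι κ _ _ x y => (hC ι κ x y).trans ?_⟩
  have hx := mnorm_nonneg x
  have hy := mnorm_nonneg y
  gcongr
  exact le_max_left _ _

/-- The linear map induced by a jointly completely bounded bilinear map is completely bounded. -/
lemma JointlyCB.lift_bound {φ : V →ₗ[ℂ] W →ₗ[ℂ] X} (h : JointlyCB φ) :
    ∃ C : ℝ, ∀ (ι : Type) [Fintype ι] (u : Matrix ι ι (AlgTensor V W)),
      mnorm (u.map (AlgTensor.lift φ)) ≤ C * mnorm u := by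
  obtain ⟨C, hC0, hC⟩ := h.exists_bound
  refine ⟨C, fun ι _ u => ?_⟩
  have key : ∀ R : ℝ, projNorm u < R → mnorm (u.map (AlgTensor.lift φ)) ≤ C * R := by
    intro R hR
    obtain ⟨κ, μ, _, _, α, x, y, β, rfl, hlt⟩ := exists_rep_lt u hR
    rw [cmul_map]
    refine (OperatorSpace.mnorm_cmul_le _ _ _).trans ?_
    have h1 : (amp (AlgTensor.mk V W) x y).map (AlgTensor.lift φ) = amp φ x y := by
      ext p q
      exact AlgTensor.lift_mk φ _ _
    rw [h1]
    have hα := opNorm_nonneg α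
    have hβ := opNorm_nonneg β
    calc _ ≤ opNorm α * (C * mnorm x * mnorm y) * opNorm β := by
          gcongr
          exact hC _ _ x y
      _ = C * (opNorm α * mnorm x * mnorm y * opNorm β) := by ring
      _ ≤ C * R := by gcongr
  have hcont : Continuous fun R : ℝ => C * R := by fun_prop
  refine ge_of_tendsto (x := 𝓝[>] (projNorm u))
    ((hcont.tendsto (projNorm u)).mono_left nhdsWithin_le_nhds) ?_
  filter_upwards [self_mem_nhdsWithin] with R hR using key R hR

lemma CompletelyBounded.exists_norm_le {T : V →ₗ[ℂ] W} (hT : CompletelyBounded T) :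
    ∃ C : ℝ, ∀ x, ‖T x‖ ≤ C * ‖x‖ := by
  obtain ⟨C, hC⟩ := hT
  refine ⟨C, fun x => ?_⟩
  have := hC Unit (Matrix.of fun _ _ => x)
  rw [OperatorSpace.mnorm_unit] at this
  rw [← OperatorSpace.mnorm_unit (T x)]
  exact this

/-- A completely bounded linear map, as a continuous linear map. -/
def CompletelyBounded.toCLM (T : V →ₗ[ℂ] W) (hT : CompletelyBounded T) : V →L[ℂ] W :=
  T.mkContinuousOfExistsBound hT.exists_norm_le

/-- The continuous linear map `V ⊗̂ W → X` with `x ⊗ y ↦ φ x y`, for a jointly completely bounded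
bilinear map `φ` with values in a complete space. -/
def ProjTensor.lift {X : Type w} [NormedAddCommGroup X] [NormedSpace ℂ X] [OperatorSpace X]
    [CompleteSpace X] (φ : V →ₗ[ℂ] W →ₗ[ℂ] X) (hφ : JointlyCB φ) : ProjTensor V W →L[ℂ] X :=
  (CompletelyBounded.toCLM (AlgTensor.lift φ) hφ.lift_bound).extend
    (Completion.toComplL (𝕜 := ℂ) (E := AlgTensor V W))

lemma ProjTensor.lift_mk {X : Type w} [NormedAddCommGroup X] [NormedSpace ℂ X] [OperatorSpace X]
    [CompleteSpace X] (φ : V →ₗ[ℂ] W →ₗ[ℂ] X) (hφ : JointlyCB φ) (x : V) (y : W) :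
    ProjTensor.lift φ hφ (ProjTensor.mk V W x y) = φ x y := by
  refine (ContinuousLinearMap.extend_eq _ Completion.denseRange_coe
    (Completion.isUniformInducing_coe _) (AlgTensor.mk V W x y)).trans ?_
  exact AlgTensor.lift_mk φ x y

lemma JointlyCB.comp_left {U : Type*} [SeminormedAddCommGroup U] [NormedSpace ℂ U]
    [OperatorSpace U] {φ : V →ₗ[ℂ] W →ₗ[ℂ] X} (h : JointlyCB φ) {T : U →ₗ[ℂ] V}
    (hT : CompletelyBounded T) : JointlyCB (φ ∘ₗ T) := by
  obtain ⟨C, hC0, hC⟩ := h.exists_bound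
  obtain ⟨K, hK⟩ := hT
  refine ⟨C * K, fun ι κ _ _ x y => ?_⟩
  refine (hC ι κ (x.map T) y).trans ?_
  have hy := mnorm_nonneg y
  rw [mul_assoc C K]
  have := hK ι x
  gcongr

lemma JointlyCB.comp_right {U : Type*} [SeminormedAddCommGroup U] [NormedSpace ℂ U]
    [OperatorSpace U] {φ : V →ₗ[ℂ] W →ₗ[ℂ] X} (h : JointlyCB φ) {T : U →ₗ[ℂ] W}
    (hT : CompletelyBounded T) : JointlyCB (φ.compl₂ T) := by
  obtain ⟨C, hC0, hC⟩ := h.exists_bound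
  obtain ⟨K, hK⟩ := hT
  refine ⟨C * K, fun ι κ _ _ x y => ?_⟩
  refine (hC ι κ x (y.map T)).trans ?_
  have hx := mnorm_nonneg x
  calc C * mnorm x * mnorm (y.map T) ≤ C * mnorm x * (K * mnorm y) := by
        gcongr
        exact hK κ y
    _ = _ := by ring

lemma JointlyCB.apply_left {φ : V →ₗ[ℂ] W →ₗ[ℂ] X} (h : JointlyCB φ) (a : V) :
    CompletelyBounded (φ a) := by
  obtain ⟨C, hC⟩ := h
  refine ⟨C * ‖a‖, fun κ _ y => ?_⟩
  have h1 := hC Unit κ (Matrix.of fun _ _ => a) y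
  rw [OperatorSpace.mnorm_unit] at h1
  refine le_trans (le_of_eq ?_) h1
  exact (OperatorSpace.mnorm_reindex (y.map (φ a)) (Equiv.punitProd κ)).symm

lemma JointlyCB.apply_right {φ : V →ₗ[ℂ] W →ₗ[ℂ] X} (h : JointlyCB φ) (b : W) :
    CompletelyBounded (φ.flip b) := by
  obtain ⟨C, hC⟩ := h
  refine ⟨C * ‖b‖, fun ι _ x => ?_⟩
  have h1 := hC ι Unit x (Matrix.of fun _ _ => b)
  rw [OperatorSpace.mnorm_unit] at h1
  refine le_trans (le_of_eq ?_) (h1.trans (le_of_eq (by ring)))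
  exact (OperatorSpace.mnorm_reindex (x.map (φ.flip b)) (Equiv.prodPUnit ι)).symm

end projectiveCompletion

/-! ### Quantized Banach algebras and bimodules -/

/-- A quantized Banach algebra: a complex algebra, not necessarily unital, which is also a
(complete) operator space such that the multiplication is (jointly) completely bounded, though not
necessarily completely contractive. -/
class QuantizedBanachAlgebra (A : Type u) extends NormedAddCommGroup A, NonUnitalRing A,
    NormedSpace ℂ A, CompleteSpace A, IsScalarTower ℂ A A, SMulCommClass ℂ A A,
    OperatorSpace A where
  mul_jointlyCB : JointlyCB (LinearMap.mul ℂ A)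

/-- A quantized Banach bimodule: a bimodule which is also an operator space, with (jointly)
completely bounded actions `lact a x = a · x` and `ract x a = x · a`. -/
class QuantizedBimodule (A : Type u) [QuantizedBanachAlgebra A] (E : Type v)
    [NormedAddCommGroup E] [NormedSpace ℂ E] [OperatorSpace E] where
  lact : A →ₗ[ℂ] E →ₗ[ℂ] E
  ract : E →ₗ[ℂ] A →ₗ[ℂ] E
  lact_mul : ∀ a b x, lact (a * b) x = lact a (lact b x)
  ract_mul : ∀ x a b, ract x (a * b) = ract (ract x a) b
  lact_ract : ∀ a x b, ract (lact a x) b = lact a (ract x b)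
  lact_jointlyCB : JointlyCB lact
  ract_jointlyCB : JointlyCB ract

section dualModule

variable {A : Type u} [QuantizedBanachAlgebra A] {E : Type v} [NormedAddCommGroup E]
  [NormedSpace ℂ E] [OperatorSpace E] [QuantizedBimodule A E]

/-- The left action on the dual module: `(a · φ)(x) = φ(x · a)`. -/
def dualLact (a : A) (φ : StrongDual ℂ E) : StrongDual ℂ E :=
  φ.comp (CompletelyBounded.toCLM ((QuantizedBimodule.ract (A := A) (E := E)).flip a)
    (QuantizedBimodule.ract_jointlyCB.apply_right a))

/-- The right action on the dual module: `(φ · a)(x) = φ(a · x)`. -/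
def dualRact (φ : StrongDual ℂ E) (a : A) : StrongDual ℂ E :=
  φ.comp (CompletelyBounded.toCLM (QuantizedBimodule.lact (A := A) (E := E) a)
    (QuantizedBimodule.lact_jointlyCB.apply_left a))

lemma dualLact_apply (a : A) (φ : StrongDual ℂ E) (x : E) :
    dualLact a φ x = φ (QuantizedBimodule.ract x a) := rfl

lemma dualRact_apply (a : A) (φ : StrongDual ℂ E) (x : E) :
    dualRact φ a x = φ (QuantizedBimodule.lact a x) := rfl

/-- A derivation into the dual of a bimodule. -/
def IsDualDerivation (D : A →ₗ[ℂ] StrongDual ℂ E) : Prop :=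
  ∀ a b, D (a * b) = dualLact a (D b) + dualRact (D a) b

/-- An inner derivation into the dual of a bimodule: `D a = a · φ - φ · a` for some `φ`. -/
def IsInnerDualDerivation (D : A →ₗ[ℂ] StrongDual ℂ E) : Prop :=
  ∃ φ : StrongDual ℂ E, ∀ a, D a = dualLact a φ - dualRact φ a

end dualModule

section properties

variable (A : Type u) [QuantizedBanachAlgebra A]

/-- Operator amenability: for every quantized Banach bimodule `E`, every completely bounded
derivation into `E*` is inner. -/
def OperatorAmenable : Prop :=
  ∀ (E : Type u) [NormedAddCommGroup E] [NormedSpace ℂ E] [CompleteSpace E] [OperatorSpace E]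
    [QuantizedBimodule A E] (D : A →ₗ[ℂ] StrongDual ℂ E),
    CompletelyBounded D → IsDualDerivation D → IsInnerDualDerivation D

/-- The multiplication operator `Δ : A ⊗̂ A → A`, `a ⊗ b ↦ a b`. -/
def mulOp : ProjTensor A A →L[ℂ] A :=
  ProjTensor.lift (LinearMap.mul ℂ A) QuantizedBanachAlgebra.mul_jointlyCB

variable {A}

/-- The left action of `A` on `A ⊗̂ A`: `a · (x ⊗ y) = (a x) ⊗ y`. -/
def tensorLact (a : A) : ProjTensor A A →L[ℂ] ProjTensor A A :=
  ProjTensor.lift (ProjTensor.mk A A ∘ₗ LinearMap.mul ℂ A a)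
    (jointlyCB_mk.comp_left (QuantizedBanachAlgebra.mul_jointlyCB.apply_left a))

/-- The right action of `A` on `A ⊗̂ A`: `(x ⊗ y) · a = x ⊗ (y a)`. -/
def tensorRact (a : A) : ProjTensor A A →L[ℂ] ProjTensor A A :=
  ProjTensor.lift ((ProjTensor.mk A A).compl₂ ((LinearMap.mul ℂ A).flip a))
    (jointlyCB_mk.comp_right (QuantizedBanachAlgebra.mul_jointlyCB.apply_right a))

lemma mulOp_mk (x y : A) : mulOp A (ProjTensor.mk A A x y) = x * y :=
  ProjTensor.lift_mk _ _ x y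

lemma tensorLact_mk (a x y : A) :
    tensorLact a (ProjTensor.mk A A x y) = ProjTensor.mk A A (a * x) y :=
  ProjTensor.lift_mk _ _ x y

lemma tensorRact_mk (a x y : A) :
    tensorRact a (ProjTensor.mk A A x y) = ProjTensor.mk A A x (y * a) :=
  ProjTensor.lift_mk _ _ x y

variable (A)

/-- Operator biprojectivity: `Δ : A ⊗̂ A → A` has a completely bounded right inverse which is a
homomorphism of bimodules. -/
def OperatorBiprojective : Prop :=
  ∃ ρ : A →ₗ[ℂ] ProjTensor A A, CompletelyBounded ρ ∧ (∀ a, mulOp A (ρ a) = a) ∧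
    (∀ a b, ρ (a * b) = tensorLact a (ρ b)) ∧ (∀ a b, ρ (a * b) = tensorRact b (ρ a))

/-- Left ideals: linear subspaces closed under left multiplication by elements of the algebra. -/
def IsLeftIdeal (I : Submodule ℂ A) : Prop := ∀ a x : A, x ∈ I → a * x ∈ I

/-- Maximal modular left ideals: maximal among proper left ideals, with a right identity `u` modulo the
ideal. -/
def IsMaximalModularLeftIdeal (I : Submodule ℂ A) : Prop :=
  IsLeftIdeal A I ∧ (∃ u : A, ∀ a : A, a - a * u ∈ I) ∧ I ≠ ⊤ ∧
    ∀ J : Submodule ℂ A, IsLeftIdeal A J → I ≤ J → J = I ∨ J = ⊤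

/-- Semisimplicity: the Jacobson radical, i.e. the intersection of all maximal modular left ideals,
is zero. -/
def IsSemisimpleAlgebra : Prop :=
  ∀ a : A, (∀ I : Submodule ℂ A, IsMaximalModularLeftIdeal A I → a ∈ I) → a = 0

/-- The Tauberian property: the elements whose Gelfand transform has compact support are dense. -/
def IsTauberian : Prop :=
  Dense {a : A | HasCompactSupport fun φ : WeakDual.characterSpace ℂ A => φ a}

/-- The existence of a (two-sided) bounded approximate identity. -/
def HasBoundedApproximateIdentity : Prop :=
  ∃ l : Filter A, l.IsApproximateUnit ∧ ∃ C : ℝ, ∀ᶠ e in l, ‖e‖ ≤ C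

end properties

end OpSpace

end

/-!
Let `Δ : A ⊗̂ A → A` be the multiplication operator, and let `e` run through a bounded approximate
identity of `A`, along an ultrafilter.

If `ρ` splits `Δ`, then the elements `ρ(e)` form a bounded approximate diagonal, since
`a · ρ(e) = ρ(a e) = ρ(e a) = ρ(e) · a`, and averaging a derivation over them shows that it is
inner (`OperatorBiprojective.operatorAmenable`).

If `A` is operator amenable, then it has a virtual diagonal: a functional `M` on `(A ⊗̂ A)*` with
`a · M = M · a` and `Δ** (a · M) = a` (`OperatorAmenable.exists_virtualDiagonal`). It arises from
the derivation `a ↦ a · M₀ - M₀ · a` into the bidual of the kernel of `Δ`, where `M₀` is the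
limit of `e ⊗ e`. The remaining hypotheses serve to show that `a · M` lies in `A ⊗̂ A`, so that
`ρ(a) = a · M` is a splitting of `Δ`. Each character `χ` is the support of a minimal idempotent
`e_χ` with `e_χ x = χ(x) e_χ` (`exists_minimal_idempotent`), and the span of these idempotents is
dense, because it contains every element with finitely supported Gelfand transform
(`eq_sum_idempotents`; semisimplicity says that the characters separate the points,
`eq_zero_of_forall_character`). For an idempotent, `e_χ · M = e_χ · M · e_χ = e_χ ⊗ e_χ`; and
`A ⊗̂ A` is norm closed in its bidual.

This produces a bounded `ρ` only. That `ρ` is completely bounded is automatic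
(`completelyBounded_of_leftModuleHom`): `ρ(a)` is the limit of `a · ρ(e)`, and the action of `A`
on `A ⊗̂ A` is completely bounded. In this way no operator space structure on the bidual of
`A ⊗̂ A` has to be compared with that of `A ⊗̂ A`.
-/

noncomputable section

namespace OpSpace

open OperatorSpace UniformSpace

universe u v w

/-! ### Bounded bilinear maps, weak* limits and approximate identities -/

section general

variable {V : Type u} [SeminormedAddCommGroup V] [NormedSpace ℂ V]
variable {W : Type v} [SeminormedAddCommGroup W] [NormedSpace ℂ W]

/-- A form of the Banach–Alaoglu theorem: an eventually bounded family of functionals converges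
weak* along every ultrafilter. -/
lemma exists_weakStar_limit {σ : Type*} (U : Ultrafilter σ) (f : σ → StrongDual ℂ V) {R : ℝ}
    (hf : ∀ᶠ i in (U : Filter σ), ‖f i‖ ≤ R) :
    ∃ g : StrongDual ℂ V, ∀ x, Tendsto (fun i => f i x) U (𝓝 (g x)) := by
  have hK := WeakDual.isCompact_closedBall (𝕜 := ℂ) (E := V) 0 R
  obtain ⟨g, -, hg⟩ := hK.ultrafilter_le_nhds (U.map fun i => StrongDual.toWeakDual (f i)) (by
    rw [Ultrafilter.coe_map, le_principal_iff, mem_map]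
    filter_upwards [hf] with i hi
    simpa using hi)
  refine ⟨WeakDual.toStrongDual g, fun x => ?_⟩
  have h1 : Tendsto (fun i => StrongDual.toWeakDual (f i)) U (𝓝 g) := hg
  exact ((WeakDual.eval_continuous x).tendsto g).comp h1

variable [OperatorSpace V] [OperatorSpace W]
variable {X : Type w} [SeminormedAddCommGroup X] [NormedSpace ℂ X] [OperatorSpace X]

lemma JointlyCB.exists_norm_le {φ : V →ₗ[ℂ] W →ₗ[ℂ] X} (h : JointlyCB φ) :
    ∃ C : ℝ, 0 ≤ C ∧ ∀ x y, ‖φ x y‖ ≤ C * ‖x‖ * ‖y‖ := by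
  obtain ⟨C, hC0, hC⟩ := h.exists_bound
  refine ⟨C, hC0, fun x y => ?_⟩
  have h1 := hC Unit Unit (Matrix.of fun _ _ => x) (Matrix.of fun _ _ => y)
  rw [mnorm_unit, mnorm_unit] at h1
  exact (norm_entry_le (amp φ (Matrix.of fun _ _ : Unit => x) (Matrix.of fun _ _ : Unit => y))
    ((), ()) ((), ())).trans h1

/-- A jointly completely bounded bilinear map, as a continuous bilinear map. -/
def JointlyCB.toCLM₂ (φ : V →ₗ[ℂ] W →ₗ[ℂ] X) (h : JointlyCB φ) : V →L[ℂ] W →L[ℂ] X :=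
  φ.mkContinuous₂ h.exists_norm_le.choose h.exists_norm_le.choose_spec.2

lemma JointlyCB.flip {φ : V →ₗ[ℂ] W →ₗ[ℂ] X} (h : JointlyCB φ) : JointlyCB φ.flip := by
  obtain ⟨C, hC⟩ := h
  refine ⟨C, fun ι κ _ _ y x => ?_⟩
  refine le_trans (le_of_eq ?_) ((hC κ ι x y).trans (le_of_eq (by ring)))
  exact mnorm_reindex (amp φ x y) (Equiv.prodComm ι κ)

lemma JointlyCB.exists_mnorm_map_le {φ : V →ₗ[ℂ] W →ₗ[ℂ] X} (h : JointlyCB φ) :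
    ∃ C : ℝ, 0 ≤ C ∧ ∀ (ι : Type) [Fintype ι] (x : Matrix ι ι V) (y : W),
      mnorm (x.map fun v => φ v y) ≤ C * mnorm x * ‖y‖ := by
  obtain ⟨C, hC0, hC⟩ := h.exists_bound
  refine ⟨C, hC0, fun ι _ x y => ?_⟩
  have h1 := hC ι Unit x (Matrix.of fun _ _ => y)
  rw [mnorm_unit] at h1
  refine le_trans (le_of_eq ?_) h1
  exact (mnorm_reindex (x.map fun v => φ v y) (Equiv.prodPUnit ι)).symm

/-- Matrix norms are continuous for entrywise convergence. -/
lemma tendsto_mnorm {σ : Type*} {l : Filter σ} {ι : Type} [Fintype ι] {f : σ → Matrix ι ι V}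
    {g : Matrix ι ι V} (h : ∀ i j, Tendsto (fun s => f s i j) l (𝓝 (g i j))) :
    Tendsto (fun s => mnorm (f s)) l (𝓝 (mnorm g)) :=
  ((uniformContinuous_mnorm (V := V) (ι := ι)).continuous.tendsto g).comp
    (tendsto_pi_nhds.2 fun i => tendsto_pi_nhds.2 fun j => h i j)

/-- A bound on operator norms passes to entrywise limits. -/
lemma opNorm_le_of_tendsto {σ : Type*} {l : Filter σ} [l.NeBot] {ι κ : Type} [Fintype ι]
    [Fintype κ] {f : σ → Matrix ι κ ℂ} {g : Matrix ι κ ℂ} {C : ℝ} (hC : 0 ≤ C)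
    (h : ∀ i j, Tendsto (fun s => f s i j) l (𝓝 (g i j)))
    (hf : ∀ᶠ s in l, opNorm (f s) ≤ C) : opNorm g ≤ C := by
  refine opNorm_le_of _ hC fun x => ?_
  have h1 : Tendsto (fun s => ∑ i, ‖∑ j, f s i j * x j‖ ^ 2) l
      (𝓝 (∑ i, ‖∑ j, g i j * x j‖ ^ 2)) :=
    tendsto_finsetSum _ fun i _ => ((tendsto_finsetSum _ fun j _ =>
      (h i j).mul_const _).norm).pow 2
  refine le_of_tendsto h1 (hf.mono fun s hs => (opNorm_sq_sum_le (f s) x).trans ?_)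
  have := opNorm_nonneg (f s)
  gcongr

/-- Continuous linear maps on `V ⊗̂ W` are determined by their values on elementary tensors. -/
lemma ProjTensor.clm_ext {Y : Type*} [NormedAddCommGroup Y] [NormedSpace ℂ Y]
    {f g : ProjTensor V W →L[ℂ] Y}
    (h : ∀ x y, f (ProjTensor.mk V W x y) = g (ProjTensor.mk V W x y)) : f = g := by
  ext t
  refine Completion.denseRange_coe.induction_on t (isClosed_eq f.continuous g.continuous)
    fun a => ?_
  have e : f.toLinearMap ∘ₗ (Completion.toComplL (𝕜 := ℂ) (E := AlgTensor V W)).toLinearMap =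
      g.toLinearMap ∘ₗ (Completion.toComplL (𝕜 := ℂ) (E := AlgTensor V W)).toLinearMap :=
    TensorProduct.ext' (M := V) (N := W) fun x y => h x y
  exact LinearMap.congr_fun e a

end general

section algebra

variable {A : Type u} [QuantizedBanachAlgebra A]

/-- The regular representation of a quantized Banach algebra on itself. -/
def mulCLM (A : Type u) [QuantizedBanachAlgebra A] : A →L[ℂ] A →L[ℂ] A :=
  JointlyCB.toCLM₂ (LinearMap.mul ℂ A) QuantizedBanachAlgebra.mul_jointlyCB

lemma mulCLM_apply (a b : A) : mulCLM A a b = a * b := rfl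

lemma HasBoundedApproximateIdentity.exists_ultrafilter (h : HasBoundedApproximateIdentity A) :
    ∃ (U : Ultrafilter A) (C : ℝ), 0 ≤ C ∧ (∀ᶠ e in (U : Filter A), ‖e‖ ≤ C) ∧
      (∀ a : A, Tendsto (fun e => a * e) U (𝓝 a)) ∧
      (∀ a : A, Tendsto (fun e => e * a) U (𝓝 a)) := by
  obtain ⟨l, hl, C, hC⟩ := h
  have := hl.neBot
  have hU : (Ultrafilter.of l : Filter A) ≤ l := Ultrafilter.of_le l
  refine ⟨Ultrafilter.of l, max C 0, le_max_right _ _, ?_, fun a => ?_, fun a => ?_⟩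
  · exact hU (hC.mono fun e he => he.trans (le_max_left _ _))
  · exact (hl.tendsto_mul_left a).mono_left hU
  · exact (hl.tendsto_mul_right a).mono_left hU

end algebra

/-! ### Gelfand theory -/

section gelfand

variable {A : Type u} [QuantizedBanachAlgebra A]

/-- The closed subalgebra of `B(A)` generated by the operators of multiplication. -/
def multiplicationAlgebra (A : Type u) [QuantizedBanachAlgebra A] : Subalgebra ℂ (A →L[ℂ] A) :=
  (Algebra.adjoin ℂ (Set.range (mulCLM A))).topologicalClosure

lemma mulCLM_mem (a : A) : mulCLM A a ∈ multiplicationAlgebra A :=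
  Subalgebra.le_topologicalClosure _ (Algebra.subset_adjoin ⟨a, rfl⟩)

/-- If the operator `1 - L_a` is not surjective, then it is not invertible, so that a character
of the commutative unital Banach algebra generated by the multiplication operators takes the
value `1` at `L_a`. Working with operators avoids a renorming of `A` and its unitization. -/
lemma exists_character_eq_one (hcomm : ∀ a b : A, a * b = b * a) (a : A)
    (ha : ¬ Function.Surjective fun x => x - a * x) :
    ∃ χ : WeakDual.characterSpace ℂ A, χ a = 1 := by
  have hadj : ∀ x y : Algebra.adjoin ℂ (Set.range (mulCLM A)), x * y = y * x := by
    refine fun x y => (Algebra.isMulCommutative_adjoin ℂ ?_).is_comm.comm x y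
    rintro _ ⟨b, rfl⟩ _ ⟨c, rfl⟩
    ext x
    change b * (c * x) = c * (b * x)
    rw [← mul_assoc, ← mul_assoc, hcomm b c]
  let : NormedCommRing (multiplicationAlgebra A) :=
    { (inferInstance : NormedRing (multiplicationAlgebra A)) with
      mul_comm := (Subalgebra.commRingTopologicalClosure _ hadj).mul_comm }
  have : CompleteSpace (multiplicationAlgebra A) :=
    (Subalgebra.isClosed_topologicalClosure _).completeSpace_coe
  let L : A →L[ℂ] multiplicationAlgebra A :=
    (mulCLM A).codRestrict (multiplicationAlgebra A).toSubmodule mulCLM_mem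
  have hL : ∀ x y, L (x * y) = L x * L y := by
    intro x y
    ext z
    exact mul_assoc x y z
  have hunit : ¬ IsUnit (1 - L a) := by
    intro h
    apply ha
    obtain ⟨b, hb⟩ := h.exists_right_inv
    intro y
    refine ⟨(b : A →L[ℂ] A) y, ?_⟩
    exact congrArg (fun T : multiplicationAlgebra A => (T : A →L[ℂ] A) y) hb
  obtain ⟨f, hf⟩ := WeakDual.CharacterSpace.exists_apply_eq_zero hunit
  rw [map_sub, map_one, sub_eq_zero] at hf
  refine ⟨⟨StrongDual.toWeakDual ((WeakDual.CharacterSpace.toCLM f).comp L), ?_, ?_⟩, hf.symm⟩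
  · intro h0
    have h1 : f (L a) = 0 := congrArg (fun g : WeakDual ℂ A => g a) h0
    rw [← hf] at h1
    exact one_ne_zero h1
  · intro x y
    change f (L (x * y)) = f (L x) * f (L y)
    rw [hL, map_mul]

/-- In a semisimple commutative algebra the characters separate the points. -/
lemma eq_zero_of_forall_character (hcomm : ∀ a b : A, a * b = b * a)
    (hss : IsSemisimpleAlgebra A) {a : A}
    (ha : ∀ χ : WeakDual.characterSpace ℂ A, χ a = 0) : a = 0 := by
  refine hss a fun I hI => ?_
  obtain ⟨hideal, ⟨u, hu⟩, hproper, hmax⟩ := hI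
  by_contra haI
  -- The ideal of all `x` with `x ∈ I + A a`; it contains `a = u a` modulo `I`.
  let J : Submodule ℂ A :=
    { carrier := {x | ∃ c, x - c * a ∈ I}
      add_mem' := by
        rintro x y ⟨c, hc⟩ ⟨d, hd⟩
        refine ⟨c + d, ?_⟩
        have := I.add_mem hc hd
        rwa [show x - c * a + (y - d * a) = x + y - (c + d) * a by rw [add_mul]; abel] at this
      zero_mem' := ⟨0, by simp⟩
      smul_mem' := by
        rintro z x ⟨c, hc⟩
        refine ⟨z • c, ?_⟩
        have := I.smul_mem z hc
        rwa [smul_sub, ← smul_mul_assoc] at this }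
  have hJ : IsLeftIdeal A J := by
    rintro b x ⟨c, hc⟩
    refine ⟨b * c, ?_⟩
    have := hideal b _ hc
    rwa [mul_sub, ← mul_assoc] at this
  have hIJ : I ≤ J := fun x hx => ⟨0, by simpa using hx⟩
  have haJ : a ∈ J := ⟨u, by rw [hcomm u a]; exact hu a⟩
  rcases hmax J hJ hIJ with h | h
  · exact haI (h ▸ haJ)
  · obtain ⟨b, hb⟩ : u ∈ J := h ▸ Submodule.mem_top
    have hns : ¬ Function.Surjective fun x => x - b * a * x := by
      intro hs
      refine hproper (eq_top_iff.2 fun y _ => ?_)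
      obtain ⟨x, rfl⟩ := hs y
      have := I.add_mem (hu x) (hideal x _ hb)
      rwa [mul_sub, sub_add_sub_cancel, hcomm x (b * a)] at this
    obtain ⟨χ, hχ⟩ := exists_character_eq_one hcomm _ hns
    rw [map_mul, ha χ, mul_zero] at hχ
    exact zero_ne_one hχ

lemma exists_character_separating {χ ψ : WeakDual.characterSpace ℂ A} (h : ψ ≠ χ) :
    ∃ b : A, ψ b = 0 ∧ χ b ≠ 0 := by
  by_contra! hker
  obtain ⟨v, hv⟩ : ∃ v, ψ v ≠ 0 := by
    by_contra! h0
    exact ψ.2.1 (ContinuousLinearMap.ext h0)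
  have key : ∀ x, χ x * ψ v = ψ x * χ v := by
    intro x
    have := hker (ψ v • x - ψ x • v) (by simp [mul_comm])
    simp only [map_sub, map_smul, smul_eq_mul, sub_eq_zero] at this
    rw [mul_comm, this]
  have h1 := key (v * v)
  simp only [map_mul] at h1
  have h2 : χ v * (χ v - ψ v) = 0 := by
    have : ψ v * (χ v * (χ v - ψ v)) = 0 := by linear_combination h1
    exact (mul_eq_zero.1 this).resolve_left hv
  rcases mul_eq_zero.1 h2 with h3 | h3
  · refine χ.2.1 (ContinuousLinearMap.ext fun x => ?_)
    have := key x
    rw [h3, mul_zero] at this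
    exact (mul_eq_zero.1 this).resolve_right hv
  · refine h (WeakDual.CharacterSpace.ext fun x => ?_)
    have := key x
    rw [sub_eq_zero.1 h3] at this
    exact (mul_right_cancel₀ hv this).symm

lemma exists_character_separating_finset (χ : WeakDual.characterSpace ℂ A)
    (F : Finset (WeakDual.characterSpace ℂ A)) (hF : χ ∉ F) :
    ∃ b : A, χ b ≠ 0 ∧ ∀ ψ ∈ F, ψ b = 0 := by
  classical
  induction F using Finset.induction_on with
  | empty =>
    by_contra! h0
    exact χ.2.1 (ContinuousLinearMap.ext fun x => by
      by_contra hx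
      obtain ⟨ψ, hψ, -⟩ := h0 x hx
      simp at hψ)
  | insert ψ F hψ ih =>
    rw [Finset.mem_insert, not_or] at hF
    obtain ⟨b, hb, hbF⟩ := ih hF.2
    obtain ⟨c, hc, hcχ⟩ := exists_character_separating (Ne.symm hF.1)
    refine ⟨b * c, by rw [map_mul]; exact mul_ne_zero hb hcχ, fun η hη => ?_⟩
    rw [map_mul]
    rcases Finset.mem_insert.1 hη with rfl | hη
    · rw [hc, mul_zero]
    · rw [hbF η hη, zero_mul]

lemma finite_support_of_hasCompactSupport [DiscreteTopology (WeakDual.characterSpace ℂ A)] {a : A}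
    (ha : HasCompactSupport fun χ : WeakDual.characterSpace ℂ A => χ a) :
    {χ : WeakDual.characterSpace ℂ A | χ a ≠ 0}.Finite :=
  (IsCompact.finite_of_discrete ha).subset (subset_tsupport _)

/-- The minimal idempotent supported at a character. The density of the elements with finitely
supported Gelfand transform replaces an appeal to Shilov's idempotent theorem. -/
lemma exists_minimal_idempotent (hcomm : ∀ a b : A, a * b = b * a)
    (hss : IsSemisimpleAlgebra A) (ht : IsTauberian A)
    [DiscreteTopology (WeakDual.characterSpace ℂ A)] (χ : WeakDual.characterSpace ℂ A) :
    ∃ e : A, χ e = 1 ∧ (∀ ψ : WeakDual.characterSpace ℂ A, ψ ≠ χ → ψ e = 0) ∧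
      ∀ x, e * x = χ x • e := by
  classical
  have hopen : IsOpen {a : A | χ a ≠ 0} := isOpen_ne.preimage (map_continuous χ)
  obtain ⟨b₀, hb₀, -⟩ := exists_character_separating_finset χ ∅ (Finset.notMem_empty χ)
  obtain ⟨a, haχ, ha⟩ := ht.inter_open_nonempty _ hopen ⟨b₀, hb₀⟩
  have hfin := finite_support_of_hasCompactSupport ha
  obtain ⟨b, hbχ, hb⟩ := exists_character_separating_finset χ (hfin.toFinset.erase χ) (by simp)
  have hne : χ (a * b) ≠ 0 := by rw [map_mul]; exact mul_ne_zero haχ hbχ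
  obtain ⟨e, h1, h2⟩ : ∃ e : A, χ e = 1 ∧
      ∀ ψ : WeakDual.characterSpace ℂ A, ψ ≠ χ → ψ e = 0 := by
    refine ⟨(χ (a * b))⁻¹ • (a * b), ?_, fun ψ hψ => ?_⟩
    · rw [map_smul, smul_eq_mul, inv_mul_cancel₀ hne]
    · rw [map_smul, map_mul ψ]
      by_cases h0 : ψ a = 0
      · simp [h0]
      · rw [hb ψ (by simp [hψ, h0])]
        simp
  refine ⟨e, h1, h2, fun x => ?_⟩
  refine sub_eq_zero.1 (eq_zero_of_forall_character hcomm hss fun ψ => ?_)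
  rw [map_sub, map_mul ψ, map_smul ψ, smul_eq_mul]
  by_cases hψ : ψ = χ
  · rw [hψ, h1]; ring
  · rw [h2 ψ hψ]; ring

/-- An element with finitely supported Gelfand transform is a combination of the minimal
idempotents. -/
lemma eq_sum_idempotents (hcomm : ∀ a b : A, a * b = b * a) (hss : IsSemisimpleAlgebra A)
    {e : WeakDual.characterSpace ℂ A → A} (h1 : ∀ χ : WeakDual.characterSpace ℂ A, χ (e χ) = 1)
    (h2 : ∀ χ ψ : WeakDual.characterSpace ℂ A, ψ ≠ χ → ψ (e χ) = 0) {a : A}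
    (ha : {χ : WeakDual.characterSpace ℂ A | χ a ≠ 0}.Finite) :
    a = ∑ χ ∈ ha.toFinset, χ a • e χ := by
  classical
  refine sub_eq_zero.1 (eq_zero_of_forall_character hcomm hss fun ψ => ?_)
  rw [map_sub, map_sum, sub_eq_zero]
  by_cases h0 : ψ a = 0
  · rw [h0, Finset.sum_eq_zero]
    intro χ hχ
    have : ψ ≠ χ := by
      rintro rfl
      simp [h0] at hχ
    rw [map_smul, h2 χ ψ this, smul_zero]
  · rw [Finset.sum_eq_single ψ]
    · rw [map_smul, h1, smul_eq_mul, mul_one]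
    · intro χ _ hχ
      rw [map_smul, h2 χ ψ (Ne.symm hχ), smul_zero]
    · simp [h0]

end gelfand

/-! ### Bimodules: `A ⊗̂ A`, sub-bimodules and dual bimodules -/

section tensorBound

variable {V : Type u} [SeminormedAddCommGroup V] [NormedSpace ℂ V] [OperatorSpace V]
variable {W : Type v} [SeminormedAddCommGroup W] [NormedSpace ℂ W] [OperatorSpace W]

/-- The operator norm of `1 ⊗ α` is at most that of `α`. -/
lemma opNorm_one_kronecker_le {ι κ μ : Type} [Fintype ι] [Fintype κ] [Fintype μ] [DecidableEq μ]
    (α : Matrix ι κ ℂ) :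
    opNorm (Matrix.kroneckerMap (· * ·) (1 : Matrix μ μ ℂ) α) ≤ opNorm α := by
  have h : Matrix.kroneckerMap (· * ·) (1 : Matrix μ μ ℂ) α =
      (Matrix.kroneckerMap (· * ·) α (1 : Matrix μ μ ℂ)).submatrix (Equiv.prodComm μ ι)
        (Equiv.prodComm μ κ) := by
    ext p q
    simp [Matrix.one_apply, mul_comm]
  rw [h]
  exact (opNorm_submatrix_equiv _ _ _).trans (opNorm_amp_le α)

lemma amp_cmul {Z X Y : Type*} [AddCommGroup Z] [Module ℂ Z] [AddCommGroup X] [Module ℂ X]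
    [AddCommGroup Y] [Module ℂ Y] {ι κ μ : Type} [Fintype ι] [Fintype κ] [DecidableEq ι]
    (ψ : Z →ₗ[ℂ] X →ₗ[ℂ] Y) (x : Matrix ι ι Z) (α : Matrix μ κ ℂ) (y : Matrix κ κ X)
    (β : Matrix κ μ ℂ) :
    amp ψ x (cmul α y β) = cmul (Matrix.kroneckerMap (· * ·) (1 : Matrix ι ι ℂ) α) (amp ψ x y)
      (Matrix.kroneckerMap (· * ·) (1 : Matrix ι ι ℂ) β) := by
  ext ⟨i, k⟩ ⟨j, l⟩
  simp [amp, cmul, Fintype.sum_prod_type, Matrix.one_apply, map_sum]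

/-- For bilinear maps on `Z × (V ⊗̂ W)`, joint complete boundedness can be tested on elementary
tensors of matrices. -/
lemma jointlyCB_of_bound_on_tensors {Z : Type*} [SeminormedAddCommGroup Z] [NormedSpace ℂ Z]
    [OperatorSpace Z] {X : Type*} [SeminormedAddCommGroup X] [NormedSpace ℂ X] [OperatorSpace X]
    (ψ : Z →ₗ[ℂ] ProjTensor V W →ₗ[ℂ] X) (hcont : ∀ z, Continuous (ψ z)) {C : ℝ} (hC : 0 ≤ C)
    (h : ∀ (ι κ μ : Type) [Fintype ι] [Fintype κ] [Fintype μ] (x : Matrix ι ι Z)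
      (v : Matrix κ κ V) (w : Matrix μ μ W),
      mnorm (amp ψ x (amp (ProjTensor.mk V W) v w)) ≤ C * mnorm x * mnorm v * mnorm w) :
    JointlyCB ψ := by
  classical
  refine ⟨C, fun ι κ _ _ x t => ?_⟩
  have hx := mnorm_nonneg x
  have hc1 : Continuous fun t : Matrix κ κ (ProjTensor V W) => mnorm (amp ψ x t) :=
    (uniformContinuous_mnorm (V := X) (ι := ι × κ)).continuous.comp
      (continuous_pi fun p => continuous_pi fun q =>
        (hcont _).comp (continuous_id.matrix_elem p.2 q.2))
  have hc2 : Continuous fun t : Matrix κ κ (ProjTensor V W) => C * mnorm x * mnorm t :=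
    continuous_const.mul continuous_complNorm
  refine denseRange_coe_matrix.induction_on t (isClosed_le hc1 hc2) fun u => ?_
  have hu : mnorm (u.map ((↑) : AlgTensor V W → ProjTensor V W)) = projNorm u := complNorm_coe u
  rw [hu]
  have key : ∀ R : ℝ, projNorm u < R →
      mnorm (amp ψ x (u.map ((↑) : AlgTensor V W → ProjTensor V W))) ≤ C * mnorm x * R := by
    intro R hR
    obtain ⟨κ', μ, _, _, α, y, z, β, rfl, hlt⟩ := exists_rep_lt u hR
    have e : (cmul α (amp (AlgTensor.mk V W) y z) β).map
        ((↑) : AlgTensor V W → ProjTensor V W) = cmul α (amp (ProjTensor.mk V W) y z) β :=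
      cmul_map (Completion.toComplL (𝕜 := ℂ) (E := AlgTensor V W)).toLinearMap α _ β
    rw [e, amp_cmul]
    refine (mnorm_cmul_le _ _ _).trans ?_
    have h1 := opNorm_one_kronecker_le (μ := ι) α
    have h2 := opNorm_one_kronecker_le (μ := ι) β
    have h3 := h ι κ' μ x y z
    have hy := mnorm_nonneg y
    have hz := mnorm_nonneg z
    have hα := opNorm_nonneg α
    have hβ := opNorm_nonneg (Matrix.kroneckerMap (· * ·) (1 : Matrix ι ι ℂ) β)
    calc _ ≤ opNorm α * (C * mnorm x * mnorm y * mnorm z) * opNorm β :=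
          mul_le_mul (mul_le_mul h1 h3 (mnorm_nonneg _) hα) h2 hβ (by positivity)
      _ = C * mnorm x * (opNorm α * mnorm y * mnorm z * opNorm β) := by ring
      _ ≤ C * mnorm x * R := by gcongr
  have hcont' : Continuous fun R : ℝ => C * mnorm x * R := by fun_prop
  refine ge_of_tendsto (x := 𝓝[>] (projNorm u))
    ((hcont'.tendsto (projNorm u)).mono_left nhdsWithin_le_nhds) ?_
  filter_upwards [self_mem_nhdsWithin] with R hR using key R hR

end tensorBound

section tensorModule

variable {A : Type u} [QuantizedBanachAlgebra A]

lemma tensorLact_mul (a b : A) (t : ProjTensor A A) :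
    tensorLact (a * b) t = tensorLact a (tensorLact b t) := by
  have : tensorLact (a * b) = (tensorLact a).comp (tensorLact b) :=
    ProjTensor.clm_ext fun x y => by
      rw [ContinuousLinearMap.comp_apply, tensorLact_mk, tensorLact_mk, tensorLact_mk, mul_assoc]
  rw [this, ContinuousLinearMap.comp_apply]

lemma tensorRact_mul (a b : A) (t : ProjTensor A A) :
    tensorRact (a * b) t = tensorRact b (tensorRact a t) := by
  have : tensorRact (a * b) = (tensorRact b).comp (tensorRact a) :=
    ProjTensor.clm_ext fun x y => by
      rw [ContinuousLinearMap.comp_apply, tensorRact_mk, tensorRact_mk, tensorRact_mk, mul_assoc]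
  rw [this, ContinuousLinearMap.comp_apply]

lemma tensorLact_tensorRact (a b : A) (t : ProjTensor A A) :
    tensorRact b (tensorLact a t) = tensorLact a (tensorRact b t) := by
  have : (tensorRact b).comp (tensorLact a) = (tensorLact a).comp (tensorRact b) :=
    ProjTensor.clm_ext fun x y => by
      rw [ContinuousLinearMap.comp_apply, ContinuousLinearMap.comp_apply, tensorLact_mk,
        tensorRact_mk, tensorRact_mk, tensorLact_mk]
  exact DFunLike.congr_fun this t

lemma mulOp_tensorLact (a : A) (t : ProjTensor A A) : mulOp A (tensorLact a t) = a * mulOp A t := by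
  have : (mulOp A).comp (tensorLact a) = (mulCLM A a).comp (mulOp A) :=
    ProjTensor.clm_ext fun x y => by
      rw [ContinuousLinearMap.comp_apply, ContinuousLinearMap.comp_apply, tensorLact_mk, mulOp_mk,
        mulOp_mk, mulCLM_apply, mul_assoc]
  exact DFunLike.congr_fun this t

lemma mulOp_tensorRact (a : A) (t : ProjTensor A A) : mulOp A (tensorRact a t) = mulOp A t * a := by
  have : (mulOp A).comp (tensorRact a) = ((mulCLM A).flip a).comp (mulOp A) :=
    ProjTensor.clm_ext fun x y => by
      rw [ContinuousLinearMap.comp_apply, ContinuousLinearMap.comp_apply, tensorRact_mk, mulOp_mk,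
        mulOp_mk, ContinuousLinearMap.flip_apply, mulCLM_apply, mul_assoc]
  exact DFunLike.congr_fun this t

/-- The left action of `A` on `A ⊗̂ A`, as a bilinear map. -/
def tensorLactₗ (A : Type u) [QuantizedBanachAlgebra A] :
    A →ₗ[ℂ] ProjTensor A A →ₗ[ℂ] ProjTensor A A :=
  LinearMap.mk₂ ℂ (fun a t => tensorLact a t)
    (fun a b t => by
      have : tensorLact (a + b) = tensorLact a + tensorLact b :=
        ProjTensor.clm_ext fun x y => by
          simp only [add_apply, tensorLact_mk, add_mul, map_add,
            LinearMap.add_apply]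
      rw [this, add_apply])
    (fun c a t => by
      have : tensorLact (c • a) = c • tensorLact a :=
        ProjTensor.clm_ext fun x y => by
          simp only [smul_apply, tensorLact_mk, smul_mul_assoc, map_smul,
            LinearMap.smul_apply]
      rw [this, smul_apply])
    (fun a s t => map_add _ s t) (fun c a t => map_smul _ c t)

/-- The right action of `A` on `A ⊗̂ A`, as a bilinear map with the algebra variable first. -/
def tensorRactₗ (A : Type u) [QuantizedBanachAlgebra A] :
    A →ₗ[ℂ] ProjTensor A A →ₗ[ℂ] ProjTensor A A :=
  LinearMap.mk₂ ℂ (fun a t => tensorRact a t)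
    (fun a b t => by
      have : tensorRact (a + b) = tensorRact a + tensorRact b :=
        ProjTensor.clm_ext fun x y => by
          simp only [add_apply, tensorRact_mk, mul_add, map_add]
      rw [this, add_apply])
    (fun c a t => by
      have : tensorRact (c • a) = c • tensorRact a :=
        ProjTensor.clm_ext fun x y => by
          simp only [smul_apply, tensorRact_mk, mul_smul_comm, map_smul]
      rw [this, smul_apply])
    (fun a s t => map_add _ s t) (fun c a t => map_smul _ c t)

lemma jointlyCB_tensorLactₗ : JointlyCB (tensorLactₗ A) := by
  obtain ⟨C, hC0, hC⟩ := (QuantizedBanachAlgebra.mul_jointlyCB (A := A)).exists_bound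
  obtain ⟨K, hK0, hK⟩ := (jointlyCB_mk (V := A) (W := A)).exists_bound
  refine jointlyCB_of_bound_on_tensors _ (fun a => (tensorLact a).continuous)
    (mul_nonneg hK0 hC0) ?_
  intro ι κ μ _ _ _ x v w
  have e : amp (tensorLactₗ A) x (amp (ProjTensor.mk A A) v w) =
      (amp (ProjTensor.mk A A) (amp (LinearMap.mul ℂ A) x v) w).submatrix
        (Equiv.prodAssoc ι κ μ).symm (Equiv.prodAssoc ι κ μ).symm := by
    ext p q
    exact tensorLact_mk _ _ _
  rw [e, mnorm_reindex]
  refine (hK _ _ _ _).trans ?_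
  have hw := mnorm_nonneg w
  calc K * mnorm (amp (LinearMap.mul ℂ A) x v) * mnorm w
      ≤ K * (C * mnorm x * mnorm v) * mnorm w := by
        gcongr
        exact hC _ _ x v
    _ = _ := by ring

lemma jointlyCB_tensorRactₗ : JointlyCB (tensorRactₗ A) := by
  obtain ⟨C, hC0, hC⟩ := (QuantizedBanachAlgebra.mul_jointlyCB (A := A)).exists_bound
  obtain ⟨K, hK0, hK⟩ := (jointlyCB_mk (V := A) (W := A)).exists_bound
  refine jointlyCB_of_bound_on_tensors _ (fun a => (tensorRact a).continuous)
    (mul_nonneg hK0 hC0) ?_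
  intro ι κ μ _ _ _ x v w
  let σ : ι × (κ × μ) ≃ κ × (μ × ι) := (Equiv.prodComm _ _).trans (Equiv.prodAssoc κ μ ι)
  have e : amp (tensorRactₗ A) x (amp (ProjTensor.mk A A) v w) =
      (amp (ProjTensor.mk A A) v (amp (LinearMap.mul ℂ A) w x)).submatrix σ σ := by
    ext p q
    exact tensorRact_mk _ _ _
  rw [e, mnorm_reindex]
  refine (hK _ _ _ _).trans ?_
  have hv := mnorm_nonneg v
  calc K * mnorm v * mnorm (amp (LinearMap.mul ℂ A) w x)
      ≤ K * mnorm v * (C * mnorm w * mnorm x) := by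
        gcongr
        exact hC _ _ w x
    _ = _ := by ring

/-- The bimodule `A ⊗̂ A`. -/
instance tensorBimodule : QuantizedBimodule A (ProjTensor A A) where
  lact := tensorLactₗ A
  ract := (tensorRactₗ A).flip
  lact_mul a b t := tensorLact_mul a b t
  ract_mul t a b := tensorRact_mul a b t
  lact_ract a t b := tensorLact_tensorRact a b t
  lact_jointlyCB := jointlyCB_tensorLactₗ
  ract_jointlyCB := jointlyCB_tensorRactₗ.flip

end tensorModule

section submodule

variable {E : Type v} [NormedAddCommGroup E] [NormedSpace ℂ E] [OperatorSpace E]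

/-- A linear subspace of an operator space, with the induced matrix norms. -/
instance submoduleOperatorSpace (S : Submodule ℂ E) : OperatorSpace S where
  mnorm v := mnorm (v.map S.subtype)
  mnorm_add_le v w := by
    rw [Matrix.map_add _ (map_add _)]
    exact mnorm_add_le _ _
  mnorm_smul c v := by
    rw [← mnorm_smul]
    rfl
  mnorm_unit x := mnorm_unit (x : E)
  mnorm_fromBlocks v w := by
    rw [Matrix.fromBlocks_map, ← mnorm_fromBlocks]
    simp
  mnorm_cmul_le α v β := by
    rw [cmul_map]
    exact mnorm_cmul_le _ _ _

variable {A : Type u} [QuantizedBanachAlgebra A] [QuantizedBimodule A E]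

open QuantizedBimodule

/-- A linear subspace of a bimodule which is stable under both actions. -/
@[reducible]
def subBimodule (S : Submodule ℂ E) (hl : ∀ (a : A) (x : E), x ∈ S → lact a x ∈ S)
    (hr : ∀ (a : A) (x : E), x ∈ S → ract x a ∈ S) : QuantizedBimodule A S where
  lact := LinearMap.mk₂ ℂ (fun a x => ⟨lact a (x : E), hl a x x.2⟩)
    (fun a b x => Subtype.ext (by simp)) (fun c a x => Subtype.ext (by simp))
    (fun a x y => Subtype.ext (by simp)) (fun c a x => Subtype.ext (by simp))
  ract := LinearMap.mk₂ ℂ (fun x a => ⟨ract (x : E) a, hr a x x.2⟩)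
    (fun a b x => Subtype.ext (by simp)) (fun c a x => Subtype.ext (by simp))
    (fun a x y => Subtype.ext (by simp)) (fun c a x => Subtype.ext (by simp))
  lact_mul a b x := Subtype.ext (lact_mul a b (x : E))
  ract_mul x a b := Subtype.ext (ract_mul (x : E) a b)
  lact_ract a x b := Subtype.ext (lact_ract a (x : E) b)
  lact_jointlyCB := by
    obtain ⟨C, hC⟩ := lact_jointlyCB (A := A) (E := E)
    exact ⟨C, fun ι κ _ _ x y => hC ι κ x (y.map S.subtype)⟩
  ract_jointlyCB := by
    obtain ⟨C, hC⟩ := ract_jointlyCB (A := A) (E := E)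
    exact ⟨C, fun ι κ _ _ x y => hC ι κ (x.map S.subtype) y⟩

end submodule

section dualBimodule

variable {A : Type u} [QuantizedBanachAlgebra A]
variable {E : Type v} [NormedAddCommGroup E] [NormedSpace ℂ E] [OperatorSpace E]
  [QuantizedBimodule A E]

open QuantizedBimodule

/-- The left action on the dual module, as a bilinear map. -/
def dualLactₗ (A : Type u) [QuantizedBanachAlgebra A] (E : Type v) [NormedAddCommGroup E]
    [NormedSpace ℂ E] [OperatorSpace E] [QuantizedBimodule A E] :
    A →ₗ[ℂ] StrongDual ℂ E →ₗ[ℂ] StrongDual ℂ E :=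
  LinearMap.mk₂ ℂ dualLact
    (fun a b f => by ext x; simp [dualLact_apply])
    (fun c a f => by ext x; simp [dualLact_apply])
    (fun a f g => by ext x; simp [dualLact_apply])
    (fun c a f => by ext x; simp [dualLact_apply])

/-- The right action on the dual module, as a bilinear map. -/
def dualRactₗ (A : Type u) [QuantizedBanachAlgebra A] (E : Type v) [NormedAddCommGroup E]
    [NormedSpace ℂ E] [OperatorSpace E] [QuantizedBimodule A E] :
    StrongDual ℂ E →ₗ[ℂ] A →ₗ[ℂ] StrongDual ℂ E :=
  LinearMap.mk₂ ℂ dualRact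
    (fun a f g => by ext x; simp [dualRact_apply])
    (fun c a f => by ext x; simp [dualRact_apply])
    (fun a b f => by ext x; simp [dualRact_apply])
    (fun c a f => by ext x; simp [dualRact_apply])

lemma jointlyCB_dualLactₗ : JointlyCB (dualLactₗ A E) := by
  obtain ⟨C, hC0, hC⟩ := (ract_jointlyCB (A := A) (E := E)).exists_bound
  refine ⟨C, fun ι κ _ _ a f => ?_⟩
  have ha := mnorm_nonneg a
  have hf := dualNorm_nonneg f
  refine dualNorm_le _ (mul_nonneg (mul_nonneg hC0 ha) hf) fun μ _ x => ?_
  let σ : (ι × κ) × μ ≃ κ × (μ × ι) :=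
    (Equiv.prodAssoc _ _ _).trans ((Equiv.prodComm _ _).trans (Equiv.prodAssoc _ _ _))
  have e : pair (amp (dualLactₗ A E) a f) x = (pair f (amp ract x a)).submatrix σ σ := rfl
  rw [e]
  refine (opNorm_submatrix_equiv _ _ _).trans ((opNorm_pair_le _ _).trans ?_)
  calc dualNorm f * mnorm (amp ract x a) ≤ dualNorm f * (C * mnorm x * mnorm a) := by
        gcongr
        exact hC _ _ x a
    _ = C * mnorm a * dualNorm f * mnorm x := by ring

lemma jointlyCB_dualRactₗ : JointlyCB (dualRactₗ A E) := by
  obtain ⟨C, hC0, hC⟩ := (lact_jointlyCB (A := A) (E := E)).exists_bound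
  refine ⟨C, fun ι κ _ _ f a => ?_⟩
  have ha := mnorm_nonneg a
  have hf := dualNorm_nonneg f
  refine dualNorm_le _ (mul_nonneg (mul_nonneg hC0 hf) ha) fun μ _ x => ?_
  let σ : (ι × κ) × μ ≃ ι × (κ × μ) := Equiv.prodAssoc _ _ _
  have e : pair (amp (dualRactₗ A E) f a) x = (pair f (amp lact a x)).submatrix σ σ := rfl
  rw [e]
  refine (opNorm_submatrix_equiv _ _ _).trans ((opNorm_pair_le _ _).trans ?_)
  calc dualNorm f * mnorm (amp lact a x) ≤ dualNorm f * (C * mnorm a * mnorm x) := by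
        gcongr
        exact hC _ _ a x
    _ = C * dualNorm f * mnorm a * mnorm x := by ring

/-- The dual bimodule. -/
instance dualBimodule : QuantizedBimodule A (StrongDual ℂ E) where
  lact := dualLactₗ A E
  ract := dualRactₗ A E
  lact_mul a b f := ContinuousLinearMap.ext fun x => congrArg f (ract_mul x a b)
  ract_mul f a b := ContinuousLinearMap.ext fun x => congrArg f (lact_mul a b x)
  lact_ract a f b := ContinuousLinearMap.ext fun x => congrArg f (lact_ract b x a)
  lact_jointlyCB := jointlyCB_dualLactₗ
  ract_jointlyCB := jointlyCB_dualRactₗ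

end dualBimodule

/-! ### Operator biprojective algebras are operator amenable -/

section amenable

variable {A : Type u} [QuantizedBanachAlgebra A]

open QuantizedBimodule

/-- If `ρ` splits the multiplication, then `ρ(e)`, with `e` running through a bounded approximate
identity, is a bounded approximate diagonal, and the limit `φ` of `∑ aₖ · D(bₖ)` for
`ρ(e) = ∑ aₖ ⊗ bₖ` implements `D` up to a derivation `D₂` with `a · D₂(b) = 0`. This `D₂` is inner
as well, implemented by the limit of `D₂(e)`; this replaces the usual reduction to essential
bimodules. -/
theorem OperatorBiprojective.operatorAmenable (hcomm : ∀ a b : A, a * b = b * a)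
    (hbai : HasBoundedApproximateIdentity A) (h : OperatorBiprojective A) :
    OperatorAmenable A := by
  intro E _ _ _ _ _ D hDcb hD
  obtain ⟨ρ, hρcb, hΔ, hρl, hρr⟩ := h
  obtain ⟨U, C, hC0, hUC, hUl, hUr⟩ := hbai.exists_ultrafilter
  let l : A →L[ℂ] StrongDual ℂ E →L[ℂ] StrongDual ℂ E :=
    JointlyCB.toCLM₂ (dualLactₗ A E) jointlyCB_dualLactₗ
  let r : StrongDual ℂ E →L[ℂ] A →L[ℂ] StrongDual ℂ E :=
    JointlyCB.toCLM₂ (dualRactₗ A E) jointlyCB_dualRactₗ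
  -- `Ψ (a ⊗ b) = a · D b`
  let Ψ : ProjTensor A A →L[ℂ] StrongDual ℂ E :=
    ProjTensor.lift ((dualLactₗ A E).compl₂ D) (jointlyCB_dualLactₗ.comp_right hDcb)
  have hΨ : ∀ a b, Ψ (ProjTensor.mk A A a b) = dualLact a (D b) :=
    fun a b => ProjTensor.lift_mk _ _ a b
  have hΨl : ∀ c t, Ψ (tensorLact c t) = dualLact c (Ψ t) := by
    intro c t
    have : Ψ.comp (tensorLact c) = (l c).comp Ψ := ProjTensor.clm_ext fun x y => by
      change Ψ (tensorLact c _) = dualLact c (Ψ _)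
      rw [tensorLact_mk, hΨ, hΨ]
      exact lact_mul c x (D y)
    exact DFunLike.congr_fun this t
  have hΨr : ∀ c t, Ψ (tensorRact c t) = dualLact (mulOp A t) (D c) + dualRact (Ψ t) c := by
    intro c t
    have : Ψ.comp (tensorRact c) = (l.flip (D c)).comp (mulOp A) + (r.flip c).comp Ψ :=
      ProjTensor.clm_ext fun x y => by
        change Ψ (tensorRact c _) = dualLact (mulOp A _) (D c) + dualRact (Ψ _) c
        rw [tensorRact_mk, hΨ, hΨ, mulOp_mk, hD y c]
        have h1 : dualLact (x * y) (D c) = dualLact x (dualLact y (D c)) := lact_mul x y (D c)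
        have h2 : dualRact (dualLact x (D y)) c = dualLact x (dualRact (D y) c) :=
          lact_ract x (D y) c
        rw [h1, h2]
        exact map_add (l x) _ _
    exact DFunLike.congr_fun this t
  obtain ⟨R, hR⟩ := hρcb.exists_norm_le
  obtain ⟨φ, hφ⟩ := exists_weakStar_limit U (fun e => Ψ (ρ e)) (R := ‖Ψ‖ * (|R| * C)) (by
    filter_upwards [hUC] with e he
    refine (Ψ.le_opNorm _).trans ?_
    have h1 : ‖ρ e‖ ≤ |R| * C := (hR e).trans
      (mul_le_mul (le_abs_self R) he (norm_nonneg _) (abs_nonneg R))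
    gcongr)
  -- the inner derivation of `φ` is the weak* limit of `e · D c`
  have key : ∀ c x, Tendsto (fun e : A => D c (ract x e)) U
      (𝓝 (dualLact c φ x - dualRact φ c x)) := by
    intro c x
    refine ((hφ (ract x c)).sub (hφ (lact c x))).congr fun e => ?_
    have h1 : tensorLact c (ρ e) = tensorRact c (ρ e) := by rw [← hρl, ← hρr, hcomm]
    have h2 := hΨl c (ρ e)
    rw [h1, hΨr, hΔ] at h2
    have h3 := DFunLike.congr_fun h2 x
    rw [add_apply, dualLact_apply, dualRact_apply, dualLact_apply] at h3
    rw [← h3]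
    ring
  let D₂ : A →L[ℂ] StrongDual ℂ E := CompletelyBounded.toCLM D hDcb - l.flip φ + r φ
  have hD₂ : ∀ a x, D₂ a x = D a x - dualLact a φ x + dualRact φ a x := fun a x => rfl
  have hD₂l : ∀ (a b : A) (x : E), D₂ b (ract x a) = 0 := by
    intro a b x
    have h1 : Tendsto (fun e : A => D b (ract x (a * e))) U (𝓝 (D b (ract x a))) :=
      (((D b).continuous.comp
        (JointlyCB.toCLM₂ (ract (A := A) (E := E)) ract_jointlyCB x).continuous).tendsto a).comp
        (hUl a)
    have h2 := key b (ract x a)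
    simp only [← ract_mul] at h2
    have h3 := tendsto_nhds_unique h1 h2
    rw [hD₂, h3]
    ring
  have hD₂r : ∀ a b x, D₂ (a * b) x = D₂ a (lact b x) := by
    intro a b x
    have h0 := hD₂l a b x
    have h1 := DFunLike.congr_fun (hD a b) x
    simp only [add_apply, hD₂, dualLact_apply, dualRact_apply] at h0 h1 ⊢
    rw [h1, lact_mul, ract_mul, lact_ract]
    linear_combination h0
  obtain ⟨ψ, hψ⟩ := exists_weakStar_limit U (fun e => D₂ e) (R := ‖D₂‖ * C) (by
    filter_upwards [hUC] with e he
    exact D₂.le_opNorm_of_le he)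
  have hψr : ∀ a x, D₂ a x = ψ (lact a x) := by
    intro a x
    have h1 : Tendsto (fun e => D₂ (e * a) x) U (𝓝 (D₂ a x)) :=
      (((ContinuousLinearMap.apply ℂ ℂ x).continuous.comp D₂.continuous).tendsto a).comp (hUr a)
    simp only [hD₂r] at h1
    exact tendsto_nhds_unique h1 (hψ (lact a x))
  have hψl : ∀ (a : A) (x : E), ψ (ract x a) = 0 := by
    intro a x
    have h1 := hψ (ract x a)
    simp only [hD₂l] at h1
    exact tendsto_nhds_unique h1 tendsto_const_nhds
  refine ⟨φ - ψ, fun a => ContinuousLinearMap.ext fun x => ?_⟩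
  have h1 := hψr a x
  have h2 := hψl a x
  simp only [sub_apply, hD₂, dualLact_apply, dualRact_apply] at h1 ⊢
  linear_combination h1 + h2

end amenable

/-! ### Virtual diagonals of operator amenable algebras -/

section virtualDiagonal

variable {A : Type u} [QuantizedBanachAlgebra A]

open QuantizedBimodule

/-- The dual of a normed space. For `E` itself a dual space, the topology and the linear structure
of `E` are read off from its norm, as the definition of operator amenability requires. -/
abbrev NDual (E : Type*) [NormedAddCommGroup E] [NormedSpace ℂ E] : Type _ := StrongDual ℂ E

/-- The kernel of the multiplication operator `A ⊗̂ A → A`. -/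
def mulKer (A : Type u) [QuantizedBanachAlgebra A] : Submodule ℂ (ProjTensor A A) :=
  LinearMap.ker (mulOp A : ProjTensor A A →ₗ[ℂ] A)

lemma mem_mulKer {t : ProjTensor A A} : t ∈ mulKer A ↔ mulOp A t = 0 := LinearMap.mem_ker

instance mulKerBimodule : QuantizedBimodule A (mulKer A) :=
  subBimodule (mulKer A)
    (fun a t ht => mem_mulKer.2 ((mulOp_tensorLact a t).trans (by rw [mem_mulKer.1 ht, mul_zero])))
    (fun a t ht => mem_mulKer.2 ((mulOp_tensorRact a t).trans (by rw [mem_mulKer.1 ht, zero_mul])))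

/-- The element `a · (e ⊗ e) - (e ⊗ e) · a` of the kernel of the multiplication operator of a
commutative algebra, as a linear function of `a`. -/
def diagCommutator (hcomm : ∀ a b : A, a * b = b * a) (e : A) : A →ₗ[ℂ] mulKer A :=
  ((tensorLactₗ A).flip (ProjTensor.mk A A e e) -
    (tensorRactₗ A).flip (ProjTensor.mk A A e e)).codRestrict (mulKer A) fun a => by
      change mulOp A (tensorLact a _ - tensorRact a _) = 0
      rw [map_sub, mulOp_tensorLact, mulOp_tensorRact, hcomm, sub_self]

lemma diagCommutator_mul (hcomm : ∀ a b : A, a * b = b * a) (e a b : A) :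
    diagCommutator hcomm e (a * b) =
      lact a (diagCommutator hcomm e b) + ract (diagCommutator hcomm e a) b := by
  apply Subtype.ext
  change tensorLact (a * b) _ - tensorRact (a * b) _ =
    tensorLact a (tensorLact b _ - tensorRact b _) + tensorRact b (tensorLact a _ - tensorRact a _)
  rw [tensorLact_mul, tensorRact_mul, map_sub, map_sub, tensorLact_tensorRact]
  abel

lemma exists_mnorm_diagCommutator_le (hcomm : ∀ a b : A, a * b = b * a) :
    ∃ B : ℝ, 0 ≤ B ∧ ∀ (e : A) (ι : Type) [Fintype ι] (x : Matrix ι ι A),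
      mnorm (x.map (diagCommutator hcomm e)) ≤ B * ‖e‖ ^ 2 * mnorm x := by
  obtain ⟨C, hC0, hC⟩ := (jointlyCB_tensorLactₗ (A := A)).exists_mnorm_map_le
  obtain ⟨C', hC'0, hC'⟩ := (jointlyCB_tensorRactₗ (A := A)).exists_mnorm_map_le
  obtain ⟨K, hK0, hK⟩ := (jointlyCB_mk (V := A) (W := A)).exists_norm_le
  refine ⟨(C + C') * K, by positivity, fun e ι _ x => ?_⟩
  have hx := mnorm_nonneg x
  set m := ProjTensor.mk A A e e with hm
  have h1 : mnorm (x.map (diagCommutator hcomm e)) =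
      mnorm ((x.map fun a => tensorLactₗ A a m) + -(x.map fun a => tensorRactₗ A a m)) := by
    refine congrArg (mnorm (V := ProjTensor A A)) (?_ :
      (x.map (diagCommutator hcomm e)).map (mulKer A).subtype = _)
    ext i j
    exact sub_eq_add_neg _ _
  rw [h1]
  refine (mnorm_add_le _ _).trans ?_
  rw [mnorm_neg]
  calc _ ≤ C * mnorm x * ‖m‖ + C' * mnorm x * ‖m‖ := add_le_add (hC ι x m) (hC' ι x m)
    _ = (C + C') * mnorm x * ‖m‖ := by ring
    _ ≤ (C + C') * mnorm x * (K * ‖e‖ * ‖e‖) := by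
        gcongr
        exact hK e e
    _ = _ := by ring

/-- An operator amenable commutative algebra with a bounded approximate identity has a virtual
diagonal, i.e. a functional `M` on `(A ⊗̂ A)*` with `a · M = M · a` and `Δ** (a · M) = a`. If `M₀`
is a weak* limit of elementary tensors `e ⊗ e`, then `a ↦ a · M₀ - M₀ · a` is a derivation into the
bidual of the kernel of `Δ`, and `M₀` is corrected by an element which implements it. -/
theorem OperatorAmenable.exists_virtualDiagonal (hcomm : ∀ a b : A, a * b = b * a)
    (hbai : HasBoundedApproximateIdentity A) (h : OperatorAmenable A) :
    ∃ M : NDual (StrongDual ℂ (ProjTensor A A)),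
      (∀ (a : A) (F : StrongDual ℂ (ProjTensor A A)),
        M (F.comp (tensorLact a)) = M (F.comp (tensorRact a))) ∧
      ∀ (a : A) (f : StrongDual ℂ A), M ((f.comp (mulOp A)).comp (tensorLact a)) = f a := by
  obtain ⟨U, C, hC0, hUC, hUl, hUr⟩ := hbai.exists_ultrafilter
  obtain ⟨B, hB0, hB⟩ := exists_mnorm_diagCommutator_le hcomm
  obtain ⟨K, hK0, hK⟩ := (jointlyCB_mk (V := A) (W := A)).exists_norm_le
  obtain ⟨L, hL0, hL⟩ := (QuantizedBanachAlgebra.mul_jointlyCB (A := A)).exists_norm_le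
  let d : A → A →ₗ[ℂ] mulKer A := diagCommutator hcomm
  have hd : ∀ᶠ e in (U : Filter A), ∀ (ι : Type) [Fintype ι] (x : Matrix ι ι A),
      mnorm (x.map (d e)) ≤ B * C ^ 2 * mnorm x := by
    filter_upwards [hUC] with e he ι _ x
    have hx := mnorm_nonneg x
    refine (hB e ι x).trans ?_
    gcongr
  -- `g a` is the element `a · M₀ - M₀ · a` of the bidual of the kernel
  have hlim : ∀ a, ∃ g : NDual (StrongDual ℂ (mulKer A)),
      ∀ f, Tendsto (fun e => f (d e a)) U (𝓝 (g f)) := by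
    intro a
    refine exists_weakStar_limit (V := StrongDual ℂ (mulKer A)) U
      (fun e => NormedSpace.inclusionInDoubleDual ℂ (mulKer A) (d e a))
      (R := B * C ^ 2 * ‖a‖) ?_
    filter_upwards [hd] with e he
    refine (NormedSpace.double_dual_bound ℂ _ _).trans ?_
    rw [← mnorm_unit, ← mnorm_unit a]
    exact he Unit (Matrix.of fun _ _ => a)
  choose g hg using hlim
  let D : A →ₗ[ℂ] NDual (StrongDual ℂ (mulKer A)) :=
    { toFun := g
      map_add' := fun a b => ContinuousLinearMap.ext fun f => by
        refine tendsto_nhds_unique (hg (a + b) f) (((hg a f).add (hg b f)).congr fun e => ?_)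
        rw [map_add, map_add]
      map_smul' := fun c a => ContinuousLinearMap.ext fun f => by
        refine tendsto_nhds_unique (hg (c • a) f) (((hg a f).const_smul c).congr fun e => ?_)
        rw [map_smul, map_smul] }
  have hDcb : CompletelyBounded D := by
    refine ⟨B * C ^ 2, fun ι _ x => ?_⟩
    have hx := mnorm_nonneg x
    refine dualNorm_le _ (by positivity) fun κ _ F => ?_
    have hF := mnorm_nonneg F
    refine opNorm_le_of_tendsto (l := (U : Filter A))
      (f := fun e => (pair F (x.map (d e))).submatrix (Equiv.prodComm ι κ) (Equiv.prodComm ι κ))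
      (by positivity) (fun p q => hg _ _) ?_
    filter_upwards [hd] with e he
    refine (opNorm_submatrix_equiv _ _ _).trans ((opNorm_pair_le _ _).trans ?_)
    rw [mul_comm]
    exact mul_le_mul_of_nonneg_right (he ι x) (dualNorm_nonneg F)
  have hDder : IsDualDerivation D := by
    intro a b
    ext f
    change g (a * b) f = g b (dualRact f a) + g a (dualLact b f)
    refine tendsto_nhds_unique (hg (a * b) f)
      (((hg b (dualRact f a)).add (hg a (dualLact b f))).congr fun e => ?_)
    change f (lact a (d e b)) + f (ract (d e a) b) = f (d e (a * b))
    rw [← map_add]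
    exact congrArg f (diagCommutator_mul hcomm e a b).symm
  obtain ⟨N, hN⟩ := h (StrongDual ℂ (mulKer A)) D hDcb hDder
  obtain ⟨M₀, hM₀⟩ := exists_weakStar_limit (V := StrongDual ℂ (ProjTensor A A)) U
    (fun e => NormedSpace.inclusionInDoubleDual ℂ (ProjTensor A A) (ProjTensor.mk A A e e))
    (R := K * C * C) (by
      filter_upwards [hUC] with e he
      refine (NormedSpace.double_dual_bound ℂ _ _).trans ((hK e e).trans ?_)
      gcongr)
  let res : StrongDual ℂ (ProjTensor A A) →L[ℂ] StrongDual ℂ (mulKer A) :=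
    ContinuousLinearMap.precomp ℂ (mulKer A).subtypeL
  refine ⟨M₀ - N.comp res, fun a F => ?_, fun a f => ?_⟩
  · have h1 := (hM₀ (F.comp (tensorLact a))).sub (hM₀ (F.comp (tensorRact a)))
    have h2 : Tendsto (fun e => res F (d e a)) U _ := hg a (res F)
    have h3 := tendsto_nhds_unique h1 (h2.congr fun e => by
      change F (tensorLact a _ - tensorRact a _) = F (tensorLact a _) - F (tensorRact a _)
      rw [map_sub])
    have h4 : g a (res F) = N (res (F.comp (tensorLact a))) - N (res (F.comp (tensorRact a))) :=
      DFunLike.congr_fun (hN a) (res F)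
    change M₀ _ - N (res _) = M₀ _ - N (res _)
    linear_combination h3 + h4
  · have h1 : Tendsto (fun e : A => a * e * e) U (𝓝 a) := by
      have h2 : Tendsto (fun e : A => (a * e - a) * e) U (𝓝 0) := by
        have h3 : Tendsto (fun e : A => L * ‖a * e - a‖ * C) U (𝓝 0) := by
          have := ((tendsto_iff_norm_sub_tendsto_zero.1 (hUl a)).const_mul L).mul_const C
          simpa using this
        refine squeeze_zero_norm' ?_ h3
        filter_upwards [hUC] with e he
        refine (hL _ _).trans ?_
        gcongr
      have h4 := h2.add (hUl a)
      rw [zero_add] at h4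
      refine h4.congr fun e => ?_
      rw [sub_mul, sub_add_cancel]
    have h5 : M₀ ((f.comp (mulOp A)).comp (tensorLact a)) = f a := by
      refine tendsto_nhds_unique (hM₀ _) (((f.continuous.tendsto a).comp h1).congr fun e => ?_)
      change f (a * e * e) = f (mulOp A (tensorLact a (ProjTensor.mk A A e e)))
      rw [tensorLact_mk, mulOp_mk]
    have h6 : res ((f.comp (mulOp A)).comp (tensorLact a)) = 0 := by
      ext t
      change f (mulOp A (tensorLact a t)) = 0
      rw [mulOp_tensorLact, mem_mulKer.1 t.2, mul_zero, map_zero]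
    change M₀ _ - N (res _) = f a
    rw [h5, h6, map_zero, sub_zero]

end virtualDiagonal

/-! ### Splitting the multiplication -/

section splitting

variable {A : Type u} [QuantizedBanachAlgebra A]

/-- In the presence of a bounded approximate identity, bounded module homomorphisms
`A → A ⊗̂ A` are automatically completely bounded, since `ρ(a) = lim a · ρ(e)`. -/
lemma completelyBounded_of_leftModuleHom (hbai : HasBoundedApproximateIdentity A)
    (ρ : A →L[ℂ] ProjTensor A A) (hρ : ∀ a b, ρ (a * b) = tensorLact a (ρ b)) :
    CompletelyBounded (ρ : A →ₗ[ℂ] ProjTensor A A) := by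
  obtain ⟨U, C, hC0, hUC, hUl, hUr⟩ := hbai.exists_ultrafilter
  obtain ⟨B, hB0, hB⟩ := (jointlyCB_tensorLactₗ (A := A)).exists_mnorm_map_le
  refine ⟨B * (‖ρ‖ * C), fun ι _ x => ?_⟩
  have hx := mnorm_nonneg x
  have h1 : Tendsto (fun e => mnorm (x.map fun a => tensorLactₗ A a (ρ e))) U
      (𝓝 (mnorm (x.map (ρ : A →ₗ[ℂ] ProjTensor A A)))) := by
    refine tendsto_mnorm fun i j => ?_
    refine ((ρ.continuous.tendsto (x i j)).comp (hUl (x i j))).congr fun e => ?_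
    exact hρ _ _
  refine le_of_tendsto h1 ?_
  filter_upwards [hUC] with e he
  refine (hB ι x (ρ e)).trans ?_
  have h2 : ‖ρ e‖ ≤ ‖ρ‖ * C := ρ.le_opNorm_of_le he
  calc B * mnorm x * ‖ρ e‖ ≤ B * mnorm x * (‖ρ‖ * C) := by gcongr
    _ = _ := by ring

/-- For a minimal idempotent `e` supported at `χ`, `e · t · e = χ(Δ t) e ⊗ e`. -/
lemma tensorLact_tensorRact_idempotent (hcomm : ∀ a b : A, a * b = b * a)
    {χ : WeakDual.characterSpace ℂ A} {e : A} (he : ∀ x, e * x = χ x • e) (t : ProjTensor A A) :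
    tensorLact e (tensorRact e t) = χ (mulOp A t) • ProjTensor.mk A A e e := by
  have : (tensorLact e).comp (tensorRact e) =
      ((WeakDual.CharacterSpace.toCLM χ).comp (mulOp A)).smulRight (ProjTensor.mk A A e e) :=
    ProjTensor.clm_ext fun x y => by
      change tensorLact e (tensorRact e _) = χ (mulOp A _) • _
      rw [tensorRact_mk, tensorLact_mk, mulOp_mk, hcomm y e, he, he, map_smul, map_smul,
        LinearMap.smul_apply, smul_smul, map_mul, mul_comm]
  exact DFunLike.congr_fun this t

/-- If `M` is a virtual diagonal, then `a · M` belongs to `A ⊗̂ A` for all `a`: this holds for the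
minimal idempotents `e`, where `e · M = e · M · e` is a multiple of `e ⊗ e`, hence on a dense
subspace. The map `ρ(a) = a · M` splits the multiplication. -/
theorem OperatorAmenable.operatorBiprojective (hcomm : ∀ a b : A, a * b = b * a)
    (hss : IsSemisimpleAlgebra A) (ht : IsTauberian A)
    [DiscreteTopology (WeakDual.characterSpace ℂ A)]
    (hbai : HasBoundedApproximateIdentity A) (h : OperatorAmenable A) :
    OperatorBiprojective A := by
  obtain ⟨M, hM, hMΔ⟩ := h.exists_virtualDiagonal hcomm hbai
  choose e h1 h2 he using exists_minimal_idempotent hcomm hss ht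
  let ι : ProjTensor A A →ₗᵢ[ℂ] NDual (StrongDual ℂ (ProjTensor A A)) :=
    NormedSpace.inclusionInDoubleDualLi ℂ (E := ProjTensor A A)
  have hι : ∀ t F, ι t F = F t := fun t F => rfl
  let actCLM : A →L[ℂ] ProjTensor A A →L[ℂ] ProjTensor A A :=
    JointlyCB.toCLM₂ (tensorLactₗ A) jointlyCB_tensorLactₗ
  -- `θ a = a · M`
  let θ : A →L[ℂ] NDual (StrongDual ℂ (ProjTensor A A)) :=
    (ContinuousLinearMap.compL ℂ (StrongDual ℂ (ProjTensor A A)) (StrongDual ℂ (ProjTensor A A)) ℂ M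
      ).comp ((ContinuousLinearMap.compL ℂ (ProjTensor A A) (ProjTensor A A) ℂ).flip.comp actCLM)
  have hθ : ∀ a F, θ a F = M (F.comp (tensorLact a)) := fun a F => rfl
  have hθe : ∀ χ : WeakDual.characterSpace ℂ A,
      θ (e χ) = ι (ProjTensor.mk A A (e χ) (e χ)) := by
    intro χ
    have hee : e χ * e χ = e χ := by rw [he, h1, one_smul]
    -- `M (χ ∘ Δ) = χ (Δ** (e · M)) = χ e = 1`
    have hχ : M ((WeakDual.CharacterSpace.toCLM χ).comp (mulOp A)) = 1 := by
      rw [← h1 χ]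
      refine Eq.trans ?_ (hMΔ (e χ) (WeakDual.CharacterSpace.toCLM χ))
      congr 1
      ext t
      change χ (mulOp A t) = χ (mulOp A (tensorLact (e χ) t))
      rw [mulOp_tensorLact, map_mul χ, h1, one_mul]
    ext F
    rw [hθ, hι]
    -- `e · M = e · (e · M) = e · M · e`, and `F (e · t · e) = F (e ⊗ e) χ (Δ t)`
    have e1 : F.comp (tensorLact (e χ)) = (F.comp (tensorLact (e χ))).comp (tensorLact (e χ)) := by
      ext t
      change F (tensorLact _ t) = F (tensorLact _ (tensorLact _ t))
      rw [← tensorLact_mul, hee]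
    have e2 : (F.comp (tensorLact (e χ))).comp (tensorRact (e χ)) =
        F (ProjTensor.mk A A (e χ) (e χ)) • (WeakDual.CharacterSpace.toCLM χ).comp (mulOp A) := by
      ext t
      change F (tensorLact _ (tensorRact _ t)) = F _ * χ (mulOp A t)
      rw [tensorLact_tensorRact_idempotent hcomm (he χ), map_smul, smul_eq_mul, mul_comm]
    rw [e1, hM, e2, map_smul, hχ, smul_eq_mul, mul_one]
  -- the range of the isometry `ι` is closed, so density reduces to finitely supported transforms
  have hrange : ∀ a, ∃ t, ι t = θ a := by
    have hclosed : IsClosed {a : A | θ a ∈ Set.range ι} :=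
      ι.isometry.isClosedEmbedding.isClosed_range.preimage θ.continuous
    have hsub : {a : A | HasCompactSupport fun χ : WeakDual.characterSpace ℂ A => χ a} ⊆
        {a : A | θ a ∈ Set.range ι} := by
      intro a ha
      have hfin := finite_support_of_hasCompactSupport ha
      refine ⟨∑ χ ∈ hfin.toFinset, χ a • ProjTensor.mk A A (e χ) (e χ), ?_⟩
      conv_rhs => rw [eq_sum_idempotents hcomm hss h1 h2 hfin]
      rw [map_sum, map_sum]
      exact Finset.sum_congr rfl fun χ _ => by rw [map_smul, map_smul, hθe]
    exact fun a => hclosed.closure_subset_iff.2 hsub (ht a)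
  choose ρ hρ using hrange
  have hρF : ∀ (a : A) (F : StrongDual ℂ (ProjTensor A A)),
      F (ρ a) = M (F.comp (tensorLact a)) := fun a F => by
    rw [← hι, hρ, hθ]
  let ρₗ : A →ₗ[ℂ] ProjTensor A A :=
    { toFun := ρ
      map_add' := fun a b => ι.injective (by rw [map_add, hρ, hρ, hρ, map_add])
      map_smul' := fun c a => ι.injective (by rw [RingHom.id_apply, map_smul, hρ, hρ, map_smul]) }
  let ρc : A →L[ℂ] ProjTensor A A := ρₗ.mkContinuous ‖θ‖ fun a => by
    rw [← ι.norm_map]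
    exact (congrArg norm (hρ a)).trans_le (θ.le_opNorm a)
  have hl : ∀ a b, ρ (a * b) = tensorLact a (ρ b) := fun a b => ι.injective (by
    ext F
    rw [hι, hι, hρF]
    refine Eq.trans ?_ (hρF b (F.comp (tensorLact a))).symm
    congr 1
    ext t
    exact congrArg F (tensorLact_mul a b t))
  have hr : ∀ a b, ρ (a * b) = tensorRact b (ρ a) := fun a b => ι.injective (by
    ext F
    rw [hι, hι, hρF]
    -- `a · M · b = a · b · M`, by the centrality of `M` and the commuting of the two actions
    have e1 : M ((F.comp (tensorRact b)).comp (tensorLact a)) =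
        M ((F.comp (tensorLact a)).comp (tensorLact b)) := by
      rw [hM b]
      congr 1
      ext t
      exact congrArg F (tensorLact_tensorRact a b t)
    refine Eq.trans ?_ (e1.symm.trans (hρF a (F.comp (tensorRact b))).symm)
    congr 1
    ext t
    exact congrArg F (tensorLact_mul a b t))
  refine ⟨ρₗ, completelyBounded_of_leftModuleHom hbai ρc hl, fun a => ?_, hl, hr⟩
  refine (SeparatingDual.eq_iff_forall_dual_eq (R := ℂ)).2 fun f => ?_
  exact (hρF a (f.comp (mulOp A))).trans (hMΔ a f)

end splitting

end OpSpace

end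

theorem mainTheorem5 (A : Type*) [OpSpace.QuantizedBanachAlgebra A]
    (hcomm : ∀ a b : A, a * b = b * a)
    (hsemisimple : OpSpace.IsSemisimpleAlgebra A)
    (htauberian : OpSpace.IsTauberian A)
    (hdiscrete : DiscreteTopology (WeakDual.characterSpace ℂ A))
    (hbai : OpSpace.HasBoundedApproximateIdentity A) :
    OpSpace.OperatorBiprojective A ↔ OpSpace.OperatorAmenable A :=
  ⟨fun h => h.operatorAmenable hcomm hbai,
    fun h => h.operatorBiprojective hcomm hsemisimple htauberian hbai⟩
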